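/- **Setting.** Let $P=(p_{ij})_{N\times N}$ be a row-stochastic matrix such that every row has at least two positive entries, and let $(c_{ij})_{N\times N}$ be a matrix with $0\le c_{ij}<1$ and $c_{ij}>0$ if and only if $p_{ij}>0$. A finite or infinite sequence over $\{1,\dots,N\}$ is called admissible if $p_{ab}>0$ for any two successive letters $a,b$. Write $\Omega_\infty$ for the set of infinite admissible sequences, and $\operatorname{diam}$ and $|\cdot|$ for diameter and norm in $\mathbb R^q$. *Cylinder sets.* Let $J_1,\dots,J_N\subset\mathbb R^q$ be non-empty compact sets with $J_i=\overline{\operatorname{int}J_i}$ and $\operatorname{diam}J_i=1$. For every finite admissible word $\sigma=(\sigma_1,\dots,\sigma_k)$ of length $k\ge 2$ let $J_\sigma$ be a set geometrically similar to one of $J_1,\dots,J_N$ (for instance to $J_{\sigma_k}$), with $$J_\sigma\subset J_{\sigma_1\cdots\sigma_{k-1}},\qquad \operatorname{diam}J_\sigma=c_{\sigma_{k-1}\sigma_k}\operatorname{diam}J_{\sigma_1\cdots\sigma_{k-1}},$$ where, for each word $\tau$, the sets $J_{\tau i}$ with distinct $i$ and $\tau i$ admissible have disjoint interiors. Assume the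 separation condition: there is $t\in(0,1)$ such that for every finite word $\tau$ (including the empty word) and all $i\ne j$ such that $\tau i$ and $\tau j$ are admissible, $$\inf\{|x-y|:x\in J_{\tau i},\,y\in J_{\tau j}\}\ \ge\ t\max\{\operatorname{diam}J_{\tau i},\operatorname{diam}J_{\tau j}\}.$$ *The measure.* Let $(\chi_i)_{i=1}^N$ be a probability vector with all $\chi_i>0$, let $\widetilde\mu$ be the law on $\Omega_\infty$ of the Markov chain with initial distribution $\chi$ and transition matrix $P$, and let $\mu=\widetilde\mu\circ\pi^{-1}$, where $\pi(\omega)$ is the unique point of $\bigcap_{k\ge1}J_{\omega_1\cdots\omega_k}$. *Quantization.* Let $r>0$ and let $d$ be the metric induced by an arbitrary norm on $\mathbb R^q$. Put $$e_{n,r}(\mu)=\inf_{1\le\operatorname{card}\alpha\le n}\Big(\int d(x,\alpha)^r\,d\mu(x)\Big)^{1/r},$$ $$\underline D_r(\mu)=\liminf_{n\to\infty}\frac{\log n}{-\log e_{n,r}(\mu)},\qquad \underline Q_r^{s}(\mu)=\liminf_{n\to\infty}n^{r/s}e_{n,r}(\mu)^r,$$ and define $\overline D_r(\mu)$, $\overline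 Q_r^{s}(\mu)$ in the same way with $\limsup$. *Graph.* Let $G$ be the directed graph on $\{1,\dots,N\}$ with an edge from $i$ to $j$ if and only if $p_{ij}>0$. For $H\subset G$ let $\Psi_H(s)$ be the spectral radius of $\big((p_{ij}c_{ij}^r)^{s/(s+r)}\big)_{i,j\in H}$, and let $s_r(H)$ be the unique $s>0$ with $\Psi_H(s)=1$, if such a number exists (for one-vertex $H$ it does not). For strongly connected components write $H_1\prec H_2$ if there is a path in $G$ from a vertex of $H_1$ to a vertex of $H_2$; $H_1$ and $H_2$ are incomparable if neither $H_1\prec H_2$ nor $H_2\prec H_1$. **Theorem.** There is a unique $s_r>0$ with $\Psi_G(s_r)=1$, and $$\underline D_r(\mu)=\overline D_r(\mu)=s_r,\qquad \underline Q_r^{s_r}(\mu)>0.$$ Moreover, $\overline Q_r^{s_r}(\mu)<\infty$ if and only if the distinct elements of $\mathcal M=\{H \text{ a strongly connected component of } G: s_r(H)=s_r\}$ are pairwise incomparable; otherwise $\underline Q_r^{s_r}(\mu)=\infty$. -/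

import Mathlib

open MeasureTheory ProbabilityTheory Filter Topology
open scoped ENNReal

noncomputable section

namespace MarkovQuantization

/-! ### Quantization of measures -/

section Quantization

variable {E : Type*} [NormedAddCommGroup E] [NormedSpace ℝ E] [MeasurableSpace E]

/-- `d(x, α) = inf_{a ∈ α} nrm (x - a)`, the distance from `x` to `α` in the metric induced
by the norm `nrm`. -/
def distTo (nrm : Seminorm ℝ E) (x : E) (α : Finset E) : ℝ≥0∞ :=
  ⨅ a ∈ α, ENNReal.ofReal (nrm (x - a))

/-- The `n`th quantization error of order `r`:
`e_{n,r}(μ) = inf { (∫ d(x,α)^r dμ(x))^{1/r} : 1 ≤ card α ≤ n }`. -/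
def quantError (nrm : Seminorm ℝ E) (μ : Measure E) (r : ℝ) (n : ℕ) : ℝ≥0∞ :=
  ⨅ (α : Finset E) (_ : 1 ≤ α.card ∧ α.card ≤ n), (∫⁻ x, distTo nrm x α ^ r ∂μ) ^ (1 / r)

/-- Upper quantization dimension of order `r`. -/
def upperQuantDim (nrm : Seminorm ℝ E) (μ : Measure E) (r : ℝ) : EReal :=
  limsup (fun n : ℕ =>
    ((Real.log n / (-Real.log (quantError nrm μ r n).toReal) : ℝ) : EReal)) atTop

/-- Lower quantization dimension of order `r`. -/
def lowerQuantDim (nrm : Seminorm ℝ E) (μ : Measure E) (r : ℝ) : EReal :=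
  liminf (fun n : ℕ =>
    ((Real.log n / (-Real.log (quantError nrm μ r n).toReal) : ℝ) : EReal)) atTop

/-- The `s`-dimensional upper quantization coefficient of order `r`. -/
def upperQuantCoeff (nrm : Seminorm ℝ E) (μ : Measure E) (r s : ℝ) : ℝ≥0∞ :=
  limsup (fun n : ℕ => (n : ℝ≥0∞) ^ (r / s) * quantError nrm μ r n ^ r) atTop

/-- The `s`-dimensional lower quantization coefficient of order `r`. -/
def lowerQuantCoeff (nrm : Seminorm ℝ E) (μ : Measure E) (r s : ℝ) : ℝ≥0∞ :=
  liminf (fun n : ℕ => (n : ℝ≥0∞) ^ (r / s) * quantError nrm μ r n ^ r) atTop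

end Quantization

section Graph

variable {N : ℕ}

/-! ### The directed graph of a transition matrix -/

/-- The word `σ` belongs to `⋃_k Ω_k`: all its transitions have positive probability. -/
def IsWord (P : Matrix (Fin N) (Fin N) ℝ) (σ : List (Fin N)) : Prop :=
  σ.IsChain (fun i j => 0 < P i j)

/-- The set `Ω_∞` of infinite admissible sequences. -/
def infWords (P : Matrix (Fin N) (Fin N) ℝ) : Set (ℕ → Fin N) :=
  {ω | ∀ h, 0 < P (ω h) (ω (h + 1))}

/-- The initial word `ω|_k` of length `k`. -/
def initWord (ω : ℕ → Fin N) (k : ℕ) : List (Fin N) :=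
  (List.range k).map ω

/-- Inside the vertex set `H` there is a path (possibly consisting of one vertex) from `i` to
`j`. -/
def PathIn (P : Matrix (Fin N) (Fin N) ℝ) (H : Finset (Fin N)) (i j : Fin N) : Prop :=
  i ∈ H ∧ j ∈ H ∧ Relation.ReflTransGen (fun a b => a ∈ H ∧ b ∈ H ∧ 0 < P a b) i j

/-- The subgraph on the nonempty vertex set `H` is strongly connected. -/
def IsStronglyConnected (P : Matrix (Fin N) (Fin N) ℝ) (H : Finset (Fin N)) : Prop :=
  H.Nonempty ∧ ∀ i ∈ H, ∀ j ∈ H, PathIn P H i j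

/-- `H ∈ SC(G)`: a maximal strongly connected subgraph. -/
def IsSCComponent (P : Matrix (Fin N) (Fin N) ℝ) (H : Finset (Fin N)) : Prop :=
  Maximal (IsStronglyConnected P) H

/-- `H₁ ≺ H₂`: some path of the whole graph leads from `H₁` to `H₂`. -/
def Precedes (P : Matrix (Fin N) (Fin N) ℝ) (H₁ H₂ : Finset (Fin N)) : Prop :=
  ∃ i ∈ H₁, ∃ j ∈ H₂, PathIn P Finset.univ i j

/-- Neither `H₁ ≺ H₂` nor `H₂ ≺ H₁`. -/
def Incomparable (P : Matrix (Fin N) (Fin N) ℝ) (H₁ H₂ : Finset (Fin N)) : Prop :=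
  ¬ Precedes P H₁ H₂ ∧ ¬ Precedes P H₂ H₁

/-! ### Critical exponents -/

/-- The matrix `A_{H,s} = ((p_ij c_ij^r)^{s/(s+r)})_{i,j ∈ H}`, with complex entries. -/
def expMatrix (P c : Matrix (Fin N) (Fin N) ℝ) (r : ℝ) (H : Finset (Fin N)) (s : ℝ) :
    Matrix H H ℂ :=
  Matrix.of fun i j => (((P i j * c i j ^ r) ^ (s / (s + r)) : ℝ) : ℂ)

/-- `Ψ_H(s)`, the spectral radius of `A_{H,s}`. -/
def specRad (P c : Matrix (Fin N) (Fin N) ℝ) (r : ℝ) (H : Finset (Fin N)) (s : ℝ) : ℝ≥0∞ :=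
  spectralRadius ℂ (expMatrix P c r H s)

/-- `s` is the unique positive number with `Ψ_H(s) = 1`, that is, `s = s_r(H)`. For
`H = univ` this says `s = s_r`. A component that consists of one vertex has no such
number. -/
def IsCriticalExponent (P c : Matrix (Fin N) (Fin N) ℝ) (r : ℝ) (H : Finset (Fin N))
    (s : ℝ) : Prop :=
  (0 < s ∧ specRad P c r H s = 1) ∧ ∀ s', 0 < s' → specRad P c r H s' = 1 → s' = s

/-- The set `𝓜` of strongly connected components `H` with `s_r(H) = s`. -/
def criticalComponents (P c : Matrix (Fin N) (Fin N) ℝ) (r s : ℝ) : Set (Finset (Fin N)) :=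
  {H | IsSCComponent P H ∧ IsCriticalExponent P c r H s}

/-! ### The Markov measure on sequences -/

/-- The probability measure `∑_i v_i δ_i` on `{1, …, N}` given by a probability vector. -/
def vecMeasure (v : Fin N → ℝ) : Measure (Fin N) :=
  ∑ i, ENNReal.ofReal (v i) • Measure.dirac i

theorem isProbabilityMeasure_vecMeasure {v : Fin N → ℝ} (hv : v ∈ stdSimplex ℝ (Fin N)) :
    IsProbabilityMeasure (vecMeasure v) := by
  constructor
  simp only [vecMeasure, Measure.coe_finsetSum, Finset.sum_apply, Measure.smul_apply,
    measure_univ, smul_eq_mul, mul_one]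
  rw [← ENNReal.ofReal_sum_of_nonneg fun i _ => hv.1 i, hv.2, ENNReal.ofReal_one]

/-- The transition kernel: given the first letters `x_0, …, x_n`, the next letter is `j` with
probability `p_{x_n j}`. -/
def stepKernel (P : Matrix (Fin N) (Fin N) ℝ) (n : ℕ) :
    Kernel ((i : Finset.Iic n) → Fin N) (Fin N) :=
  (Kernel.ofFunOfCountable fun i : Fin N => vecMeasure (P i)).comap
    (fun x => x ⟨n, Finset.mem_Iic.2 le_rfl⟩) (measurable_pi_apply _)

theorem isMarkovKernel_stepKernel {P : Matrix (Fin N) (Fin N) ℝ}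
    (hP : ∀ i, P i ∈ stdSimplex ℝ (Fin N)) (n : ℕ) : IsMarkovKernel (stepKernel P n) :=
  ⟨fun x => isProbabilityMeasure_vecMeasure (hP (x ⟨n, Finset.mem_Iic.2 le_rfl⟩))⟩

/-- The law `μ̃` of the Markov chain with initial distribution `χ` and transition matrix `P`,
on the space of all sequences; it is carried by `Ω_∞`. -/
def markovMeasure (P : Matrix (Fin N) (Fin N) ℝ) (χ : Fin N → ℝ)
    (hP : ∀ i, P i ∈ stdSimplex ℝ (Fin N)) (hχ : χ ∈ stdSimplex ℝ (Fin N)) :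
    Measure (ℕ → Fin N) :=
  haveI := isProbabilityMeasure_vecMeasure hχ
  haveI := isMarkovKernel_stepKernel hP
  Kernel.trajMeasure (X := fun _ => Fin N) (vecMeasure χ) (stepKernel P)

end Graph

section Fractal

variable {N : ℕ} {E : Type*} [NormedAddCommGroup E] [NormedSpace ℝ E]

/-! ### Ratio-specified graph directed constructions -/

/-- `J` assigns to every nonempty admissible word its cylinder set; the values of `J` at other
words play no role. The sets of order one are nonempty compact, regular closed and of diameter
one. Every further cylinder set is geometrically similar to a cylinder set of order one (most
commonly to the one of its last letter), and only the ratios of the diameters are prescribed. -/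
structure IsCylinderSystem (P c : Matrix (Fin N) (Fin N) ℝ) (J : List (Fin N) → Set E) :
    Prop where
  nonempty : ∀ i, (J [i]).Nonempty
  isCompact : ∀ i, IsCompact (J [i])
  regular : ∀ i, closure (interior (J [i])) = J [i]
  diam_one : ∀ i, Metric.diam (J [i]) = 1
  subset : ∀ σ a i, IsWord P (σ ++ [a, i]) → J (σ ++ [a, i]) ⊆ J (σ ++ [a])
  nonoverlapping : ∀ σ a i j, IsWord P (σ ++ [a, i]) → IsWord P (σ ++ [a, j]) → i ≠ j →
    Disjoint (interior (J (σ ++ [a, i]))) (interior (J (σ ++ [a, j])))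
  similar : ∀ σ a i, IsWord P (σ ++ [a, i]) →
    ∃ (j : Fin N) (f : E ≃ᵈ E), J (σ ++ [a, i]) = f '' J [j]
  diam_ratio : ∀ σ a i, IsWord P (σ ++ [a, i]) →
    Metric.diam (J (σ ++ [a, i])) = c a i * Metric.diam (J (σ ++ [a]))

/-- The separation condition: for every word `σ`, including the empty one, two distinct
successors `σ∗i`, `σ∗j` satisfy `d(J_{σ∗i}, J_{σ∗j}) ≥ t max(diam J_{σ∗i}, diam J_{σ∗j})`. -/
def IsSeparated (P : Matrix (Fin N) (Fin N) ℝ) (J : List (Fin N) → Set E) : Prop :=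
  ∃ t : ℝ, 0 < t ∧ t < 1 ∧ ∀ (σ : List (Fin N)) (i j : Fin N), i ≠ j →
    IsWord P (σ ++ [i]) → IsWord P (σ ++ [j]) →
      ∀ x ∈ J (σ ++ [i]), ∀ y ∈ J (σ ++ [j]),
        t * max (Metric.diam (J (σ ++ [i]))) (Metric.diam (J (σ ++ [j]))) ≤ dist x y

open Classical in
/-- The projection `π`: for `ω ∈ Ω_∞` the point of `⋂_{k ≥ 1} J_{ω|_k}`; `0` elsewhere. -/
def proj (P : Matrix (Fin N) (Fin N) ℝ) (J : List (Fin N) → Set E) (ω : ℕ → Fin N) : E :=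
  if h : ω ∈ infWords P ∧ (⋂ k : ℕ, J (initWord ω (k + 1))).Nonempty then h.2.some else 0

/-- The Markov-type measure `μ = μ̃ ∘ π⁻¹`. -/
def markovTypeMeasure [MeasurableSpace E] (P : Matrix (Fin N) (Fin N) ℝ) (χ : Fin N → ℝ)
    (hP : ∀ i, P i ∈ stdSimplex ℝ (Fin N)) (hχ : χ ∈ stdSimplex ℝ (Fin N))
    (J : List (Fin N) → Set E) : Measure E :=
  (markovMeasure P χ hP hχ).map (proj P J)

end Fractal

end MarkovQuantization

end

/-! Write `h = p c ^ r` and `θ = s / (s + r)`. Along an admissible word σ the product of the entries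
of `h` is, up to the bounded factor χ, the number μ̃[σ] (diam J_σ)^r, the cost of serving the
cylinder of σ by one point. Cut every infinite word as soon as this product falls below ε. The cut
words partition the sequence space and all have weight between ηε and ε. One point per cut word
gives an error of order at most ε · (number of cut words). Conversely, by separation a point can be
close to at most one cut cylinder, so k points leave at least half of 2k cylinders badly served, and
the error is at least of order εk. Everything is thus reduced to counting cut words
(`quantError_rpow_le`, `le_quantError_rpow_of_isSeparated`).

Let N_i(ε) be ε^θ times the number of cut words starting at i. Cutting off the first letter gives
the renewal equation N_i(ε) = ∑_j h_ij^θ N_j(ε / h_ij) for ε ≤ 1, so bounds on N come from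
subsolutions and supersolutions. At the critical θ the matrix `h ^ θ` has spectral radius one. A
subinvariant vector bounds N below; for larger θ the matrix is subcritical and N is bounded above.
This gives the dimension and the positive lower coefficient.

For the upper coefficient, suppose first that the critical components are pairwise incomparable. Off
their union the matrix is subcritical, and a supersolution is assembled from the harmonic vectors of
the components, a decaying term downstream and a large term elsewhere
(`HasBounds.normCount_bounded`). If instead one critical component leads to another, bounded counts
would produce by monotone iteration a nonnegative fixed vector, positive on the first component and
on a vertex just outside it. A strongly connected block of radius one admits no such leak
(`IsStronglyConnected.eq_of_isSubVec`), so the counts, and with them the lower coefficient, diverge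
(`le_normCount_of_precedes`). -/

/-! ### Spectral radii of nonnegative matrices through sub- and supervectors. -/

section NonnegativeMatrices

variable {ι : Type*}

-- By Gelfand's formula some power satisfies ‖a^n‖ ≤ q^n with n ≥ 1. The truncated Neumann series u
-- = ∑_{k<n} q^{-k} a^k 1 then works: applying a / q shifts the sum by one, and the new last term is
-- at most the lost first term 1.
open scoped Matrix.Norms.Operator in
theorem exists_pos_mulVec_le_of_spectralRadius_lt [Fintype ι] [DecidableEq ι] (a : Matrix ι ι ℝ)
    {q : ℝ} (hq : 0 < q)
    (h : spectralRadius ℂ (a.map ((↑) : ℝ → ℂ)) < ENNReal.ofReal q)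
    (ha : ∀ i j, 0 ≤ a i j) :
    ∃ u : ι → ℝ, (∀ i, 0 < u i) ∧ ∀ i, a.mulVec u i ≤ q * u i := by
  have : CompleteSpace (Matrix ι ι ℂ) := FiniteDimensional.complete ℂ _
  have hlim := spectrum.pow_nnnorm_pow_one_div_tendsto_nhds_spectralRadius
    (a.map ((↑) : ℝ → ℂ))
  obtain ⟨n, hn, hn1⟩ := ((hlim.eventually_lt_const h).and (eventually_ge_atTop 1)).exists
  have hnorm : ‖(a.map ((↑) : ℝ → ℂ)) ^ n‖ ≤ q ^ n := by
    have hn0 : (0 : ℝ) < n := by exact_mod_cast hn1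
    have h1 : ((‖(a.map ((↑) : ℝ → ℂ)) ^ n‖₊ : ℝ≥0∞) ^ (1 / n : ℝ)) ^ (n : ℝ) ≤
        ENNReal.ofReal q ^ (n : ℝ) := ENNReal.rpow_le_rpow hn.le hn0.le
    rw [← ENNReal.rpow_mul, one_div_mul_cancel hn0.ne', ENNReal.rpow_one, ENNReal.rpow_natCast,
      ← ENNReal.ofReal_pow hq.le] at h1
    rw [← ENNReal.ofReal_le_ofReal_iff (by positivity), ofReal_norm]
    exact h1
  have hpow : ∀ k, (a.map ((↑) : ℝ → ℂ)) ^ k = (a ^ k).map ((↑) : ℝ → ℂ) := fun k =>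
    (map_pow (Complex.ofRealHom.mapMatrix) a k).symm
  have hle : ∀ i, (a ^ n).mulVec (fun _ => 1) i ≤ q ^ n := by
    intro i
    have h2 := Matrix.linfty_opNorm_mulVec ((a.map ((↑) : ℝ → ℂ)) ^ n) (fun _ => (1 : ℂ))
    have h3 : ‖(fun _ : ι => (1 : ℂ))‖ ≤ 1 := by
      simpa using pi_norm_const_le (ι := ι) (1 : ℂ)
    have h4 := norm_le_pi_norm (((a.map ((↑) : ℝ → ℂ)) ^ n).mulVec (fun _ => (1 : ℂ))) i
    have h5 : ((a.map ((↑) : ℝ → ℂ)) ^ n).mulVec (fun _ => (1 : ℂ)) i =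
        (((a ^ n).mulVec (fun _ => 1) i : ℝ) : ℂ) := by
      rw [hpow]
      simp [Matrix.mulVec, dotProduct]
    rw [h5, Complex.norm_real] at h4
    calc _ ≤ ‖(a ^ n).mulVec (fun _ => 1) i‖ := Real.le_norm_self _
      _ ≤ _ := h4
      _ ≤ _ := h2
      _ ≤ q ^ n * 1 := by gcongr
      _ = _ := mul_one _
  have hnn : ∀ k i, 0 ≤ (a ^ k).mulVec (fun _ => 1) i := by
    intro k i
    have : ∀ k, ∀ i j, 0 ≤ (a ^ k) i j := by
      intro k
      induction k with
      | zero => intro i j; simp [Matrix.one_apply]; split_ifs <;> norm_num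
      | succ k ih =>
        intro i j
        rw [pow_succ, Matrix.mul_apply]
        exact Finset.sum_nonneg fun l _ => mul_nonneg (ih i l) (ha l j)
    exact Finset.sum_nonneg fun j _ => mul_nonneg (this k i j) zero_le_one
  refine ⟨fun i => ∑ k ∈ Finset.range n, (q ^ k)⁻¹ * (a ^ k).mulVec (fun _ => 1) i, ?_, ?_⟩
  · intro i
    -- The term k = 0 equals 1 and makes the sum positive, which needs n ≥ 1.
    obtain ⟨m, rfl⟩ : ∃ m, n = m + 1 := ⟨n - 1, by omega⟩
    dsimp only
    rw [Finset.sum_range_succ']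
    have : 0 ≤ ∑ k ∈ Finset.range m, (q ^ (k + 1))⁻¹ * (a ^ (k + 1)).mulVec (fun _ => 1) i :=
      Finset.sum_nonneg fun k _ => mul_nonneg (by positivity) (hnn _ _)
    simp only [pow_zero, inv_one, Matrix.one_mulVec, mul_one]
    linarith
  · intro i
    set b : ℕ → ℝ := fun k => (q ^ k)⁻¹ * (a ^ k).mulVec (fun _ => 1) i with hb
    have h6 : a.mulVec (fun i => ∑ k ∈ Finset.range n,
        (q ^ k)⁻¹ * (a ^ k).mulVec (fun _ => 1) i) i = q * ∑ k ∈ Finset.range n, b (k + 1) := by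
      have : (fun i => ∑ k ∈ Finset.range n, (q ^ k)⁻¹ * (a ^ k).mulVec (fun _ => 1) i) =
          ∑ k ∈ Finset.range n, (q ^ k)⁻¹ • (a ^ k).mulVec (fun _ => 1) := by
        ext i; simp
      rw [this, Matrix.mulVec_sum, Finset.sum_apply, Finset.mul_sum]
      refine Finset.sum_congr rfl fun k _ => ?_
      rw [Matrix.mulVec_smul, Matrix.mulVec_mulVec, ← pow_succ', hb]
      simp only [Pi.smul_apply, smul_eq_mul]
      rw [pow_succ q k]
      field_simp
    rw [h6]
    have h7 := Finset.sum_range_succ b n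
    rw [Finset.sum_range_succ'] at h7
    have h8 : b n ≤ 1 := by
      simp only [hb]
      rw [inv_mul_le_iff₀ (by positivity), mul_one]
      exact hle i
    have h9 : b 0 = 1 := by simp [hb]
    have : ∑ k ∈ Finset.range n, b (k + 1) ≤ ∑ k ∈ Finset.range n, b k := by linarith
    exact mul_le_mul_of_nonneg_left this hq.le

-- Take the moduli of the entries of an eigenvector for an eigenvalue of maximal modulus and use the
-- triangle inequality.
open scoped Matrix.Norms.Operator in
theorem exists_le_mulVec_of_le_spectralRadius [Fintype ι] [DecidableEq ι] (a : Matrix ι ι ℝ)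
    {R : ℝ} (hR : 0 < R)
    (h : ENNReal.ofReal R ≤ spectralRadius ℂ (a.map ((↑) : ℝ → ℂ)))
    (ha : ∀ i j, 0 ≤ a i j) :
    ∃ v : ι → ℝ, (∀ i, 0 ≤ v i) ∧ (∃ i, 0 < v i) ∧ ∀ i, R * v i ≤ a.mulVec v i := by
  have : CompleteSpace (Matrix ι ι ℂ) := FiniteDimensional.complete ℂ _
  -- On an empty index set the spectral radius is 0, which is less than `R`.
  have hne : Nontrivial (Matrix ι ι ℂ) := by
    by_contra hcon
    rw [not_nontrivial_iff_subsingleton] at hcon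
    rw [spectrum.SpectralRadius.of_subsingleton] at h
    simp at h
    linarith
  obtain ⟨k, hk, hk2⟩ := spectrum.exists_nnnorm_eq_spectralRadius (a.map ((↑) : ℝ → ℂ))
  rw [← Matrix.spectrum_toLin', ← Module.End.hasEigenvalue_iff_mem_spectrum] at hk
  obtain ⟨z, hz⟩ := hk.exists_hasEigenvector
  have hz1 := hz.apply_eq_smul
  rw [Matrix.toLin'_apply] at hz1
  have hRk : R ≤ ‖k‖ := by
    rw [← hk2, ← enorm_eq_nnnorm, ← ofReal_norm] at h
    exact (ENNReal.ofReal_le_ofReal_iff (norm_nonneg _)).1 h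
  refine ⟨fun i => ‖z i‖, fun i => norm_nonneg _, ?_, ?_⟩
  · obtain ⟨i, hi⟩ := Function.ne_iff.1 hz.2
    exact ⟨i, norm_pos_iff.2 hi⟩
  · intro i
    have h1 := congrFun hz1 i
    calc R * ‖z i‖ ≤ ‖k‖ * ‖z i‖ := by gcongr
      _ = ‖(k • z) i‖ := by simp
      _ = ‖∑ j, (a i j : ℂ) * z j‖ := by rw [← h1]; rfl
      _ ≤ ∑ j, ‖(a i j : ℂ) * z j‖ := norm_sum_le _ _
      _ = ∑ j, a i j * ‖z j‖ := by
        refine Finset.sum_congr rfl fun j _ => ?_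
        rw [norm_mul, Complex.norm_real, Real.norm_of_nonneg (ha i j)]
      _ = _ := rfl

/-- The spectral radius of the block of `a` on the vertex set `H`. -/
noncomputable def blockRadius [DecidableEq ι] (a : Matrix ι ι ℝ) (H : Finset ι) : ℝ≥0∞ :=
  spectralRadius ℂ (Matrix.of fun i j : H => ((a i j : ℝ) : ℂ))

/-- `v` is a nonzero nonnegative vector on `H` with `R v ≤ a v` on `H`. -/
def IsSubVec (a : Matrix ι ι ℝ) (H : Finset ι) (R : ℝ) (v : ι → ℝ) : Prop :=
  (∀ i, 0 ≤ v i) ∧ (∃ i ∈ H, 0 < v i) ∧ ∀ i ∈ H, R * v i ≤ ∑ j ∈ H, a i j * v j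

/-- `u` is a positive vector with `a u ≤ q u` on `H`. -/
def IsSupVec (a : Matrix ι ι ℝ) (H : Finset ι) (q : ℝ) (u : ι → ℝ) : Prop :=
  (∀ i, 0 < u i) ∧ ∀ i ∈ H, ∑ j ∈ H, a i j * u j ≤ q * u i

variable {a : Matrix ι ι ℝ} {H : Finset ι}

/-- The ratio of two vectors attains its maximum on `H`. -/
theorem exists_max_ratio {v u : ι → ℝ} (hu : ∀ i ∈ H, 0 < u i) (hv : ∃ i ∈ H, 0 < v i) :
    ∃ κ > 0, (∀ j ∈ H, v j ≤ κ * u j) ∧ ∃ i ∈ H, v i = κ * u i := by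
  obtain ⟨i₀, hi₀, hv0⟩ := hv
  obtain ⟨i, hi, hmax⟩ := H.exists_max_image (fun i => v i / u i) ⟨i₀, hi₀⟩
  refine ⟨v i / u i, lt_of_lt_of_le (div_pos hv0 (hu i₀ hi₀)) (hmax i₀ hi₀), fun j hj => ?_,
    i, hi, ?_⟩
  · exact (div_le_iff₀ (hu j hj)).1 (hmax j hj)
  · exact (div_mul_cancel₀ _ (hu i hi).ne').symm

/-- Compare the two inequalities at an index where v / u is largest. -/
theorem IsSubVec.le_of_isSupVec (ha : ∀ i j, 0 ≤ a i j) {R q : ℝ} {v u : ι → ℝ}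
    (hv : IsSubVec a H R v) (hu : IsSupVec a H q u) : R ≤ q := by
  obtain ⟨κ, hκ, hle, i, hi, heq⟩ := exists_max_ratio (fun i _ => hu.1 i) hv.2.1
  have h1 : R * v i ≤ q * v i := calc
    R * v i ≤ ∑ j ∈ H, a i j * v j := hv.2.2 i hi
    _ ≤ ∑ j ∈ H, a i j * (κ * u j) :=
      Finset.sum_le_sum fun j hj => mul_le_mul_of_nonneg_left (hle j hj) (ha i j)
    _ = κ * ∑ j ∈ H, a i j * u j := by
      rw [Finset.mul_sum]; exact Finset.sum_congr rfl fun j _ => by ring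
    _ ≤ κ * (q * u i) := mul_le_mul_of_nonneg_left (hu.2 i hi) hκ.le
    _ = q * v i := by rw [heq]; ring
  have h2 : 0 < v i := heq ▸ mul_pos hκ (hu.1 i)
  exact le_of_mul_le_mul_right h1 h2

variable [DecidableEq ι]

theorem exists_isSupVec (ha : ∀ i j, 0 ≤ a i j) {q : ℝ} (hq : 0 < q)
    (h : blockRadius a H < ENNReal.ofReal q) : ∃ u, IsSupVec a H q u := by
  obtain ⟨u, hu, hau⟩ := exists_pos_mulVec_le_of_spectralRadius_lt
    (Matrix.of fun i j : H => a i j) hq h (fun i j => ha i j)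
  refine ⟨fun i => if hi : i ∈ H then u ⟨i, hi⟩ else 1, fun i => ?_, fun i hi => ?_⟩
  · dsimp only
    split_ifs
    exacts [hu _, one_pos]
  · rw [← Finset.sum_coe_sort H]
    simpa [hi, Matrix.mulVec, dotProduct] using hau ⟨i, hi⟩

theorem exists_isSubVec (ha : ∀ i j, 0 ≤ a i j) {R : ℝ} (hR : 0 < R)
    (h : ENNReal.ofReal R ≤ blockRadius a H) :
    ∃ v, IsSubVec a H R v ∧ ∀ i ∉ H, v i = 0 := by
  obtain ⟨u, hu, ⟨i₀, hi₀⟩, hau⟩ := exists_le_mulVec_of_le_spectralRadius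
    (Matrix.of fun i j : H => a i j) hR h (fun i j => ha i j)
  refine ⟨fun i => if hi : i ∈ H then u ⟨i, hi⟩ else 0, ⟨fun i => ?_, ⟨i₀, i₀.2, ?_⟩,
    fun i hi => ?_⟩, fun i hi => by simp [hi]⟩
  · dsimp only
    split_ifs
    exacts [hu _, le_rfl]
  · simpa using hi₀
  · rw [← Finset.sum_coe_sort H]
    simpa [hi, Matrix.mulVec, dotProduct] using hau ⟨i, hi⟩

/-- With `IsSupVec.blockRadius_le` this is the Collatz–Wielandt principle: from here on the radius
is estimated only by exhibiting test vectors, never by eigenvectors. -/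
theorem IsSubVec.le_blockRadius (ha : ∀ i j, 0 ≤ a i j) {R : ℝ} {v : ι → ℝ}
    (hv : IsSubVec a H R v) : ENNReal.ofReal R ≤ blockRadius a H := by
  by_contra! hcon
  obtain ⟨q, hq0, hq, hqR⟩ := ENNReal.lt_iff_exists_real_btwn.1 hcon
  have hq' : 0 < q := by
    by_contra! h
    rw [ENNReal.ofReal_of_nonpos h] at hq
    exact absurd hq (by simp)
  obtain ⟨u, hu⟩ := exists_isSupVec ha hq' hq
  exact absurd ((ENNReal.ofReal_lt_ofReal_iff_of_nonneg hq0).1 hqR)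
    (not_lt.2 (hv.le_of_isSupVec ha hu))

theorem IsSupVec.blockRadius_le (ha : ∀ i j, 0 ≤ a i j) {q : ℝ} {u : ι → ℝ} (hq : 0 ≤ q)
    (hu : IsSupVec a H q u) : blockRadius a H ≤ ENNReal.ofReal q := by
  by_contra! hcon
  obtain ⟨R, hR0, hqR, hR⟩ := ENNReal.lt_iff_exists_real_btwn.1 hcon
  have hqR' := (ENNReal.ofReal_lt_ofReal_iff_of_nonneg hq).1 hqR
  obtain ⟨v, hv, -⟩ := exists_isSubVec ha (hq.trans_lt hqR') hR.le
  exact absurd hqR' (not_lt.2 (hv.le_of_isSupVec ha hu))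

theorem IsSubVec.mono (ha : ∀ i j, 0 ≤ a i j) {H' : Finset ι} (hH : H ⊆ H') {R : ℝ} {v : ι → ℝ}
    (hv : IsSubVec a H R v) (hv0 : ∀ i ∉ H, v i = 0) : IsSubVec a H' R v := by
  refine ⟨hv.1, hv.2.1.imp fun i hi => ⟨hH hi.1, hi.2⟩, fun i _ => ?_⟩
  by_cases hi' : i ∈ H
  · exact (hv.2.2 i hi').trans (Finset.sum_le_sum_of_subset_of_nonneg hH
      fun j _ _ => mul_nonneg (ha i j) (hv.1 j))
  · rw [hv0 i hi', mul_zero]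
    exact Finset.sum_nonneg fun j _ => mul_nonneg (ha i j) (hv.1 j)

theorem blockRadius_mono (ha : ∀ i j, 0 ≤ a i j) {H' : Finset ι} (hH : H ⊆ H') :
    blockRadius a H ≤ blockRadius a H' := by
  by_contra! hcon
  obtain ⟨R, hR0, hqR, hR⟩ := ENNReal.lt_iff_exists_real_btwn.1 hcon
  have hR' : 0 < R := by
    by_contra! h
    rw [ENNReal.ofReal_of_nonpos h] at hqR
    exact absurd hqR (by simp)
  obtain ⟨v, hv, hv0⟩ := exists_isSubVec ha hR' hR.le
  exact absurd hqR (not_lt.2 ((hv.mono ha hH hv0).le_blockRadius ha))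

end NonnegativeMatrices

/-! ### Entrywise powers of a matrix and the exponent at which the radius is one. -/

section CriticalExponent

theorem exists_lt_rpow {b y : ℝ} (hb : 0 < b) (hy : y < 1) :
    ∃ δ₀ : ℝ, 0 < δ₀ ∧ ∀ δ : ℝ, 0 ≤ δ → δ < δ₀ → y < b ^ δ := by
  have h1 : Tendsto (fun δ : ℝ => b ^ δ) (𝓝 0) (𝓝 1) := by
    simpa using (Real.continuous_const_rpow hb.ne').tendsto 0
  obtain ⟨δ₀, hδ₀, h⟩ := Metric.eventually_nhds_iff.1 (h1.eventually_const_lt hy)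
  exact ⟨δ₀, hδ₀, fun δ h0 hlt => h (by rwa [Real.dist_0_eq_abs, abs_of_nonneg h0])⟩

variable {ι : Type*}

/-- Bounds `η ≤ h i j ≤ ρ < 1` for the positive entries of the nonnegative matrix `h`. -/
structure HasBounds (h : Matrix ι ι ℝ) (η ρ : ℝ) : Prop where
  pos : 0 < η
  le_one : η ≤ 1
  rho_pos : 0 < ρ
  rho_lt_one : ρ < 1
  nonneg : ∀ i j, 0 ≤ h i j
  le_rho : ∀ i j, h i j ≤ ρ
  eta_le : ∀ i j, 0 < h i j → η ≤ h i j

theorem exists_hasBounds [Finite ι] {h : Matrix ι ι ℝ} (h0 : ∀ i j, 0 ≤ h i j)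
    (h1 : ∀ i j, h i j < 1) : ∃ η ρ, HasBounds h η ρ := by
  obtain ⟨ρ, hρ, hρ1⟩ : ∃ ρ < 1, ∀ p : ι × ι, h p.1 p.2 ≤ ρ := by
    have : ∀ᶠ ρ in 𝓝[<] (1 : ℝ), ∀ p : ι × ι, h p.1 p.2 ≤ ρ := by
      rw [eventually_all]
      intro p
      exact (eventually_ge_nhds (h1 p.1 p.2)).filter_mono nhdsWithin_le_nhds
    obtain ⟨ρ, hρ, hlt⟩ := (this.and self_mem_nhdsWithin).exists
    exact ⟨ρ, hlt, hρ⟩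
  obtain ⟨η, hη, hη1⟩ : ∃ η > 0, ∀ p : ι × ι, 0 < h p.1 p.2 → η ≤ h p.1 p.2 := by
    have : ∀ᶠ η in 𝓝[>] (0 : ℝ), ∀ p : ι × ι, 0 < h p.1 p.2 → η ≤ h p.1 p.2 := by
      rw [eventually_all]
      intro p
      by_cases hp : 0 < h p.1 p.2
      · exact ((eventually_le_nhds hp).filter_mono nhdsWithin_le_nhds).mono fun _ h _ => h
      · exact Eventually.of_forall fun _ h => absurd h hp
    obtain ⟨η, hη, hlt⟩ := (this.and self_mem_nhdsWithin).exists
    exact ⟨η, hlt, hη⟩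
  refine ⟨min η 1, max ρ 2⁻¹, lt_min hη one_pos, min_le_right _ _,
    lt_max_of_lt_right (by norm_num), max_lt hρ (by norm_num), h0,
    fun i j => (hρ1 (i, j)).trans (le_max_left _ _),
    fun i j hij => (min_le_left _ _).trans (hη1 (i, j) hij)⟩

/-- The entrywise power of a matrix. -/
noncomputable def powMatrix (h : Matrix ι ι ℝ) (θ : ℝ) : Matrix ι ι ℝ :=
  Matrix.of fun i j => h i j ^ θ

theorem powMatrix_apply (h : Matrix ι ι ℝ) (θ : ℝ) (i j : ι) :
    powMatrix h θ i j = h i j ^ θ := rfl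

variable {h : Matrix ι ι ℝ} {η ρ : ℝ}

theorem HasBounds.powMatrix_nonneg (hb : HasBounds h η ρ) (θ : ℝ) (i j : ι) :
    0 ≤ powMatrix h θ i j := Real.rpow_nonneg (hb.nonneg i j) _

theorem HasBounds.powMatrix_pos_iff (hb : HasBounds h η ρ) {θ : ℝ} (hθ : 0 < θ) (i j : ι) :
    0 < powMatrix h θ i j ↔ 0 < h i j := by
  refine ⟨fun hlt => (hb.nonneg i j).lt_of_ne' fun h0 => ?_, fun h0 => Real.rpow_pos_of_pos h0 _⟩
  rw [powMatrix_apply, h0, Real.zero_rpow hθ.ne'] at hlt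
  exact hlt.false

theorem HasBounds.powMatrix_le (hb : HasBounds h η ρ) {θ θ' : ℝ} (hθ : 0 < θ) (hle : θ ≤ θ')
    (i j : ι) : powMatrix h θ' i j ≤ ρ ^ (θ' - θ) * powMatrix h θ i j := by
  rcases (hb.nonneg i j).eq_or_lt with h0 | h0
  · simp [powMatrix_apply, ← h0, Real.zero_rpow hθ.ne', Real.zero_rpow (hθ.trans_le hle).ne']
  · rw [powMatrix_apply, powMatrix_apply, show θ' = (θ' - θ) + θ by ring, Real.rpow_add h0]
    have := hb.le_rho i j
    have h1 : 0 ≤ θ' - θ := by linarith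
    simp only [sub_add_cancel]
    gcongr

theorem HasBounds.le_powMatrix (hb : HasBounds h η ρ) {θ θ' : ℝ} (hθ : 0 < θ) (hle : θ ≤ θ')
    (i j : ι) : η ^ (θ' - θ) * powMatrix h θ i j ≤ powMatrix h θ' i j := by
  rcases (hb.nonneg i j).eq_or_lt with h0 | h0
  · simp [powMatrix_apply, ← h0, Real.zero_rpow hθ.ne', Real.zero_rpow (hθ.trans_le hle).ne']
  · rw [powMatrix_apply, powMatrix_apply, show θ' = (θ' - θ) + θ by ring, Real.rpow_add h0]
    have := hb.eta_le i j h0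
    have h1 : 0 ≤ θ' - θ := by linarith
    have h2 := hb.pos
    simp only [sub_add_cancel]
    gcongr

theorem HasBounds.pow_lt_div (hb : HasBounds h η ρ) {n : ℕ} {i j : ι} {ε : ℝ}
    (hε : ρ ^ (n + 1) < ε) (hij : 0 < h i j) : ρ ^ n < ε / h i j := by
  rw [lt_div_iff₀ hij]
  refine lt_of_le_of_lt ?_ hε
  rw [pow_succ]
  exact mul_le_mul_of_nonneg_left (hb.le_rho i j) (pow_nonneg hb.rho_pos.le _)

theorem HasBounds.div_le (hb : HasBounds h η ρ) {i j : ι} {ε x : ℝ}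
    (hε0 : 0 < ε) (hε : ε ≤ η * x) (hij : 0 < h i j) : ε / h i j ≤ x := by
  have hx : 0 < x := pos_of_mul_pos_right (hε0.trans_le hε) hb.pos.le
  rw [div_le_iff₀ hij, mul_comm]
  exact hε.trans (mul_le_mul_of_nonneg_right (hb.eta_le i j hij) hx.le)

variable {H : Finset ι}

theorem IsSupVec.of_le_mul {a b : Matrix ι ι ℝ} {t q : ℝ} {u : ι → ℝ} (hu : IsSupVec a H q u)
    (hle : ∀ i j, b i j ≤ t * a i j) (ht : 0 ≤ t) : IsSupVec b H (t * q) u := by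
  refine ⟨hu.1, fun i hi => ?_⟩
  calc ∑ j ∈ H, b i j * u j ≤ ∑ j ∈ H, t * (a i j * u j) :=
        Finset.sum_le_sum fun j _ => by
          rw [← mul_assoc]; exact mul_le_mul_of_nonneg_right (hle i j) (hu.1 j).le
    _ = t * ∑ j ∈ H, a i j * u j := by rw [Finset.mul_sum]
    _ ≤ t * (q * u i) := mul_le_mul_of_nonneg_left (hu.2 i hi) ht
    _ = _ := by ring

theorem IsSubVec.of_mul_le {a b : Matrix ι ι ℝ} {t R : ℝ} {v : ι → ℝ} (hv : IsSubVec a H R v)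
    (hle : ∀ i j, t * a i j ≤ b i j) (ht : 0 ≤ t) : IsSubVec b H (t * R) v := by
  refine ⟨hv.1, hv.2.1, fun i hi => ?_⟩
  calc t * R * v i = t * (R * v i) := by ring
    _ ≤ t * ∑ j ∈ H, a i j * v j := mul_le_mul_of_nonneg_left (hv.2.2 i hi) ht
    _ = ∑ j ∈ H, t * (a i j * v j) := by rw [Finset.mul_sum]
    _ ≤ _ := Finset.sum_le_sum fun j _ => by
          rw [← mul_assoc]; exact mul_le_mul_of_nonneg_right (hle i j) (hv.1 j)

variable [DecidableEq ι]

/-- Raising the exponent multiplies each entry by at most ρ^(θ' - θ) < 1, and a supervector for q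
slightly above 1 absorbs this factor. -/
theorem HasBounds.blockRadius_lt_one (hb : HasBounds h η ρ) {θ θ' : ℝ} (hθ : 0 < θ)
    (hlt : θ < θ') (hle : blockRadius (powMatrix h θ) H ≤ 1) :
    blockRadius (powMatrix h θ') H < 1 := by
  have hδ : 0 < θ' - θ := by linarith
  have hρ : ρ ^ (θ' - θ) < 1 := Real.rpow_lt_one hb.rho_pos.le hb.rho_lt_one hδ
  have hρ0 : 0 < ρ ^ (θ' - θ) := Real.rpow_pos_of_pos hb.rho_pos _
  obtain ⟨q, hq1, hq2⟩ := exists_between ((one_lt_inv₀ hρ0).2 hρ)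
  have hq0 : 0 < q := by linarith
  obtain ⟨u, hu⟩ := exists_isSupVec (hb.powMatrix_nonneg θ) hq0
    (hle.trans_lt (by rwa [ENNReal.one_lt_ofReal]))
  have h1 := (hu.of_le_mul (hb.powMatrix_le hθ hlt.le) hρ0.le).blockRadius_le
    (hb.powMatrix_nonneg θ') (by positivity)
  refine h1.trans_lt ?_
  rw [ENNReal.ofReal_lt_one]
  calc ρ ^ (θ' - θ) * q < ρ ^ (θ' - θ) * (ρ ^ (θ' - θ))⁻¹ := by gcongr
    _ = 1 := mul_inv_cancel₀ hρ0.ne'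

/-- The exponent is the supremum of those in (0, 1) with radius at least one. For small θ the two or
more positive entries of each row exceed 1/2, so the constant vector is a subvector; near θ = 1 the
row sums are below one. -/
theorem HasBounds.exists_blockRadius_eq_one [Fintype ι] [Nonempty ι] (hb : HasBounds h η ρ)
    (h2 : ∀ i, 2 ≤ (Finset.univ.filter fun j => 0 < h i j).card) {q : ℝ} (hq : q < 1)
    (hsum : ∀ i, ∑ j, h i j ≤ q) :
    ∃ θ, 0 < θ ∧ θ < 1 ∧ blockRadius (powMatrix h θ) Finset.univ = 1 := by
  have hq0 : 0 ≤ q := (Finset.sum_nonneg fun j _ => hb.nonneg _ _).trans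
    (hsum (Classical.arbitrary ι))
  set S : Set ℝ := {θ | 0 < θ ∧ θ < 1 ∧ 1 ≤ blockRadius (powMatrix h θ) Finset.univ} with hS
  obtain ⟨θ₀, hθ₀⟩ : S.Nonempty := by
    obtain ⟨δ₀, hδ₀, hlt⟩ := exists_lt_rpow hb.pos (show (2⁻¹ : ℝ) < 1 by norm_num)
    have hm : 0 < min (δ₀ / 2) 2⁻¹ := by positivity
    refine ⟨min (δ₀ / 2) 2⁻¹, hm, (min_le_right _ _).trans_lt (by norm_num), ?_⟩
    have h3 := hlt _ hm.le ((min_le_left _ _).trans_lt (by linarith))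
    set θ := min (δ₀ / 2) 2⁻¹
    have hv : IsSubVec (powMatrix h θ) Finset.univ 1 (fun _ => 1) := by
      refine ⟨fun _ => zero_le_one, ⟨Classical.arbitrary ι, Finset.mem_univ _, one_pos⟩,
        fun i _ => ?_⟩
      simp only [mul_one]
      calc (1 : ℝ) = 2 * 2⁻¹ := by norm_num
        _ ≤ ((Finset.univ.filter fun j => 0 < h i j).card : ℝ) * 2⁻¹ := by
          gcongr; exact_mod_cast h2 i
        _ = ∑ j ∈ Finset.univ.filter fun j => 0 < h i j, (2⁻¹ : ℝ) := by
          rw [Finset.sum_const, nsmul_eq_mul]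
        _ ≤ ∑ j ∈ Finset.univ.filter fun j => 0 < h i j, powMatrix h θ i j := by
          refine Finset.sum_le_sum fun j hj => h3.le.trans ?_
          exact Real.rpow_le_rpow hb.pos.le (hb.eta_le i j (Finset.mem_filter.1 hj).2) hm.le
        _ ≤ ∑ j, powMatrix h θ i j := Finset.sum_le_sum_of_subset_of_nonneg
          (Finset.filter_subset _ _) fun j _ _ => hb.powMatrix_nonneg θ i j
    simpa using hv.le_blockRadius (hb.powMatrix_nonneg θ)
  obtain ⟨δ₁, hδ₁, hlt₁⟩ := exists_lt_rpow hb.pos hq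
  have hub : ∀ θ ∈ S, θ ≤ 1 - δ₁ := by
    rintro θ ⟨h0, h1, h3⟩
    by_contra! hcon
    have h4 := hlt₁ (1 - θ) (by linarith) (by linarith)
    have hpos : 0 < η ^ (1 - θ) := Real.rpow_pos_of_pos hb.pos _
    have hu : IsSupVec (powMatrix h θ) Finset.univ (q / η ^ (1 - θ)) (fun _ => 1) := by
      refine ⟨fun _ => one_pos, fun i _ => ?_⟩
      simp only [mul_one]
      rw [le_div_iff₀ hpos, mul_comm, Finset.mul_sum]
      refine (Finset.sum_le_sum fun j _ => ?_).trans (hsum i)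
      simpa [powMatrix_apply] using hb.le_powMatrix h0 h1.le i j
    have h5 := h3.trans (hu.blockRadius_le (hb.powMatrix_nonneg θ) (by positivity))
    rw [ENNReal.one_le_ofReal, one_le_div hpos] at h5
    linarith
  have hbdd : BddAbove S := ⟨_, hub⟩
  have hle := le_csSup hbdd hθ₀
  have hlt1 : sSup S < 1 := (csSup_le ⟨_, hθ₀⟩ hub).trans_lt (by linarith)
  have hpos : 0 < sSup S := hθ₀.1.trans_le hle
  set θ := sSup S with hθ
  refine ⟨θ, hpos, hlt1, le_antisymm ?_ ?_⟩
  -- A subvector with factor R > 1 survives a small increase of θ, which contradicts the supremum.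
  · by_contra! hcon
    obtain ⟨R, hR0, hR1, hR⟩ := ENNReal.lt_iff_exists_real_btwn.1 hcon
    rw [ENNReal.one_lt_ofReal] at hR1
    obtain ⟨v, hv, -⟩ := exists_isSubVec (hb.powMatrix_nonneg θ) (by linarith) hR.le
    obtain ⟨δ₀, hδ₀, hlt⟩ := exists_lt_rpow hb.pos (inv_lt_one_of_one_lt₀ hR1)
    obtain ⟨δ, hδ, hδ'⟩ := exists_between (lt_min hδ₀ (show 0 < 1 - θ by linarith))
    have hδ2 := hlt δ hδ.le (hδ'.trans_le (min_le_left _ _))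
    have hδ3 := hδ'.trans_le (min_le_right _ _)
    have hv' := (hv.of_mul_le (hb.le_powMatrix hpos (show θ ≤ θ + δ by linarith))
      (Real.rpow_nonneg hb.pos.le _)).le_blockRadius (hb.powMatrix_nonneg _)
    have hmem : θ + δ ∈ S := by
      refine ⟨by linarith, by linarith, le_trans ?_ hv'⟩
      rw [ENNReal.one_le_ofReal, add_sub_cancel_left]
      calc (1 : ℝ) = R⁻¹ * R := (inv_mul_cancel₀ (by linarith)).symm
        _ ≤ _ := by gcongr
    have := le_csSup hbdd hmem
    linarith
  -- A supervector with factor below 1 survives a small decrease of θ, which reaches an element of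
  -- `S`.
  · by_contra! hcon
    obtain ⟨q', hq0', hq1, hq2⟩ := ENNReal.lt_iff_exists_real_btwn.1 hcon
    rw [ENNReal.ofReal_lt_one] at hq2
    have hq' : 0 < q' := by
      by_contra! h
      rw [ENNReal.ofReal_of_nonpos h] at hq1
      exact absurd hq1 (by simp)
    obtain ⟨u, hu⟩ := exists_isSupVec (hb.powMatrix_nonneg θ) hq' hq1
    obtain ⟨δ₀, hδ₀, hlt⟩ := exists_lt_rpow hb.pos hq2
    obtain ⟨θ', hθ', hθ2⟩ := exists_lt_of_lt_csSup ⟨_, hθ₀⟩ (show θ - δ₀ < sSup S by linarith)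
    have hθ3 := le_csSup hbdd hθ'
    have hη := hlt (θ - θ') (by linarith) (by linarith)
    have hηpos : 0 < η ^ (θ - θ') := Real.rpow_pos_of_pos hb.pos _
    have hu' := (hu.of_le_mul (b := powMatrix h θ') (t := (η ^ (θ - θ'))⁻¹) (fun i j => by
      rw [le_inv_mul_iff₀ hηpos]
      exact hb.le_powMatrix hθ'.1 hθ3 i j) (by positivity)).blockRadius_le
        (hb.powMatrix_nonneg _) (by positivity)
    have := hθ'.2.2.trans hu'
    rw [ENNReal.one_le_ofReal, le_inv_mul_iff₀ hηpos] at this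
    linarith

end CriticalExponent

namespace MarkovQuantization

/-! ### Rigidity on strongly connected blocks, and location of critical components. -/

section StronglyConnected

variable {N : ℕ} {P a : Matrix (Fin N) (Fin N) ℝ} {H : Finset (Fin N)}

/-- A maximum principle. Where v / f is maximal, v ≤ a v and a f + e ≤ f force equality, so the leak
e vanishes there and every successor in H is again a maximum point; strong connectivity carries this
to all of H. -/
theorem IsStronglyConnected.eq_of_isSubVec (ha : ∀ i j, 0 ≤ a i j)
    (hP : ∀ i j, 0 < P i j → 0 < a i j) (hH : IsStronglyConnected P H) {f v e : Fin N → ℝ}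
    (hf : ∀ i ∈ H, 0 < f i) (hv : IsSubVec a H 1 v) (he : ∀ i ∈ H, 0 ≤ e i)
    (hfe : ∀ i ∈ H, ∑ j ∈ H, a i j * f j + e i ≤ f i) :
    ∀ i ∈ H, e i = 0 ∧ ∑ j ∈ H, a i j * f j = f i := by
  obtain ⟨κ, hκ, hle, i₀, hi₀, heq⟩ := exists_max_ratio hf hv.2.1
  have key : ∀ i ∈ H, v i = κ * f i → (e i = 0 ∧ ∑ j ∈ H, a i j * f j = f i) ∧
      ∀ j ∈ H, 0 < P i j → v j = κ * f j := by
    intro i hi hvi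
    have h1 : κ * f i ≤ ∑ j ∈ H, a i j * v j := by simpa [hvi] using hv.2.2 i hi
    have h2 : ∑ j ∈ H, a i j * v j ≤ ∑ j ∈ H, a i j * (κ * f j) :=
      Finset.sum_le_sum fun j hj => mul_le_mul_of_nonneg_left (hle j hj) (ha i j)
    have h3 : ∑ j ∈ H, a i j * (κ * f j) = κ * ∑ j ∈ H, a i j * f j := by
      rw [Finset.mul_sum]; exact Finset.sum_congr rfl fun j _ => by ring
    have h4 : f i ≤ ∑ j ∈ H, a i j * f j := by
      rw [h3] at h2
      exact le_of_mul_le_mul_left (h1.trans h2) hκ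
    have h5 := hfe i hi
    have h6 := he i hi
    refine ⟨⟨by linarith, by linarith⟩, fun j hj hPj => ?_⟩
    have h7 : ∑ j ∈ H, a i j * v j = ∑ j ∈ H, a i j * (κ * f j) := by
      refine le_antisymm h2 ?_
      rw [h3]
      refine le_trans (mul_le_mul_of_nonneg_left ?_ hκ.le) h1
      linarith
    have h8 := (Finset.sum_eq_sum_iff_of_le fun j hj =>
      mul_le_mul_of_nonneg_left (hle j hj) (ha i j)).1 h7 j hj
    exact mul_left_cancel₀ (hP i j hPj).ne' h8
  intro i hi
  have hpath := (hH.2 i₀ hi₀ i hi).2.2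
  have : i ∈ H ∧ v i = κ * f i := by
    induction hpath with
    | refl => exact ⟨hi₀, heq⟩
    | tail _ hbc ih => exact ⟨hbc.2.1, (key _ hbc.1 (ih hbc.1).2).2 _ hbc.2.1 hbc.2.2⟩
  exact (key i hi this.2).1

/-- Supervectors for factors tending to 1, normalised to the simplex so that the limit is not zero,
have a limit point f with a f ≤ f. Positivity at one vertex spreads backwards along paths. -/
theorem IsStronglyConnected.exists_pos_le (ha : ∀ i j, 0 ≤ a i j)
    (hP : ∀ i j, 0 < P i j → 0 < a i j) (hH : IsStronglyConnected P H)
    (hr : blockRadius a H ≤ 1) :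
    ∃ f : Fin N → ℝ, (∀ i, 0 ≤ f i) ∧ (∀ i ∈ H, 0 < f i) ∧
      ∀ i ∈ H, ∑ j ∈ H, a i j * f j ≤ f i := by
  have hex : ∀ k : ℕ, ∃ w ∈ stdSimplex ℝ (Fin N), (∀ i ∉ H, w i = 0) ∧
      ∀ i ∈ H, ∑ j ∈ H, a i j * w j ≤ (1 + 1 / ((k : ℝ) + 1)) * w i := by
    intro k
    have hk : (0 : ℝ) < 1 / ((k : ℝ) + 1) := by positivity
    obtain ⟨u, hu⟩ := exists_isSupVec (H := H) ha (show 0 < 1 + 1 / ((k : ℝ) + 1) by positivity)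
      (hr.trans_lt (by rw [ENNReal.one_lt_ofReal]; linarith))
    have hS : 0 < ∑ j ∈ H, u j := Finset.sum_pos (fun j _ => hu.1 j) hH.1
    refine ⟨fun i => if i ∈ H then u i / ∑ j ∈ H, u j else 0, ⟨fun i => ?_, ?_⟩,
      fun i hi => by simp [hi], fun i hi => ?_⟩
    · dsimp only
      split_ifs
      exacts [(div_pos (hu.1 i) hS).le, le_rfl]
    · rw [Finset.sum_ite_mem, Finset.univ_inter, ← Finset.sum_div, div_self hS.ne']
    · have h1 : ∑ j ∈ H, a i j * (if j ∈ H then u j / ∑ j ∈ H, u j else 0) =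
          (∑ j ∈ H, a i j * u j) / ∑ j ∈ H, u j := by
        rw [Finset.sum_div]
        exact Finset.sum_congr rfl fun j hj => by rw [if_pos hj]; ring
      simp only [h1, if_pos hi]
      rw [← mul_div_assoc]
      exact div_le_div_of_nonneg_right (hu.2 i hi) hS.le
  choose w hw hw0 hwle using hex
  obtain ⟨f, hf, φ, hφ, hlim⟩ := (isCompact_stdSimplex ℝ (Fin N)).tendsto_subseq hw
  have hlim' : ∀ i, Tendsto (fun k => w (φ k) i) atTop (𝓝 (f i)) := fun i =>
    ((continuous_apply i).tendsto f).comp hlim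
  have hf0 : ∀ i ∉ H, f i = 0 := fun i hi =>
    tendsto_nhds_unique (hlim' i) (by simp [hw0 _ i hi])
  have hle : ∀ i ∈ H, ∑ j ∈ H, a i j * f j ≤ f i := by
    intro i hi
    have h1 : Tendsto (fun k => ∑ j ∈ H, a i j * w (φ k) j) atTop
        (𝓝 (∑ j ∈ H, a i j * f j)) := tendsto_finsetSum _ fun j _ => (hlim' j).const_mul _
    have h2 : Tendsto (fun k => (1 + 1 / ((φ k : ℝ) + 1)) * w (φ k) i) atTop
        (𝓝 ((1 + 0) * f i)) := by
      refine Tendsto.mul (tendsto_const_nhds.add ?_) (hlim' i)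
      exact tendsto_one_div_add_atTop_nhds_zero_nat.comp hφ.tendsto_atTop
    simpa using le_of_tendsto_of_tendsto' h1 h2 fun k => hwle (φ k) i hi
  refine ⟨f, hf.1, fun i hi => ?_, hle⟩
  obtain ⟨j, hj⟩ : ∃ j, 0 < f j := by
    by_contra! hcon
    have := Finset.sum_nonpos (s := Finset.univ) fun j _ => hcon j
    rw [hf.2] at this
    linarith
  have hjH : j ∈ H := by
    by_contra h
    rw [hf0 j h] at hj
    exact hj.false
  have hpath := (hH.2 i hi j hjH).2.2
  clear hi
  induction hpath using Relation.ReflTransGen.head_induction_on with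
  | refl => exact hj
  | @head x y hxy _ ih =>
    refine lt_of_lt_of_le ?_ (hle x hxy.1)
    exact Finset.sum_pos' (fun l _ => mul_nonneg (ha x l) (hf.1 l))
      ⟨y, hxy.2.1, mul_pos (hP _ _ hxy.2.2) ih⟩

theorem IsStronglyConnected.exists_isSCComponent (hH : IsStronglyConnected P H) :
    ∃ H', H ⊆ H' ∧ IsSCComponent P H' :=
  Finite.exists_le_maximal hH

theorem PathIn.mono {H' : Finset (Fin N)} (hle : H ⊆ H') {i j : Fin N} (h : PathIn P H i j) :
    PathIn P H' i j :=
  ⟨hle h.1, hle h.2.1, h.2.2.lift id fun _ _ hab => ⟨hle hab.1, hle hab.2.1, hab.2.2⟩⟩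

theorem PathIn.trans {i j k : Fin N} (h : PathIn P H i j) (h' : PathIn P H j k) :
    PathIn P H i k :=
  ⟨h.1, h'.2.1, h.2.2.trans h'.2.2⟩

theorem IsSCComponent.eq_of_mem {H' : Finset (Fin N)} (hH : IsSCComponent P H)
    (hH' : IsSCComponent P H') {x : Fin N} (hx : x ∈ H) (hx' : x ∈ H') : H = H' := by
  have hconn : IsStronglyConnected P (H ∪ H') := by
    refine ⟨⟨x, Finset.mem_union_left _ hx⟩, ?_⟩
    have hto : ∀ i ∈ H ∪ H', PathIn P (H ∪ H') i x ∧ PathIn P (H ∪ H') x i := by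
      intro i hi
      rcases Finset.mem_union.1 hi with hi | hi
      · exact ⟨(hH.1.2 i hi x hx).mono Finset.subset_union_left,
          (hH.1.2 x hx i hi).mono Finset.subset_union_left⟩
      · exact ⟨(hH'.1.2 i hi x hx').mono Finset.subset_union_right,
          (hH'.1.2 x hx' i hi).mono Finset.subset_union_right⟩
    exact fun i hi j hj => (hto i hi).1.trans (hto j hj).2
  exact (hH.eq_of_le hconn Finset.subset_union_left).trans
    (hH'.eq_of_le hconn Finset.subset_union_right).symm

-- Take a subvector supported in Z. Among the vertices of its support, one whose reachable set
-- within the support is smallest has a strongly connected reachable set. No mass of the subvector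
-- leaves that set, so the block there still has radius at least one.
open Classical in
theorem exists_isSCComponent_of_one_le_blockRadius (ha : ∀ i j, 0 ≤ a i j)
    (hP : ∀ i j, 0 < a i j → 0 < P i j) (huniv : blockRadius a Finset.univ ≤ 1)
    {Z : Finset (Fin N)} (hZ : 1 ≤ blockRadius a Z) :
    ∃ H, IsSCComponent P H ∧ blockRadius a H = 1 ∧ ∃ i ∈ H, i ∈ Z := by
  obtain ⟨v, hv, hv0⟩ := exists_isSubVec ha one_pos (by simpa using hZ)
  set E : Fin N → Fin N → Prop := fun x y => 0 < v x ∧ 0 < v y ∧ 0 < P x y with hE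
  set reach : Fin N → Finset (Fin N) := fun i =>
    Finset.univ.filter fun j => Relation.ReflTransGen E i j with hreach
  have hmem : ∀ i j, j ∈ reach i ↔ Relation.ReflTransGen E i j := fun i j => by simp [hreach]
  obtain ⟨i₀, hi₀Z, hi₀⟩ := hv.2.1
  obtain ⟨i, hi, hmin⟩ := (Finset.univ.filter fun i => 0 < v i).exists_min_image
    (fun i => (reach i).card) ⟨i₀, by simpa using hi₀⟩
  replace hi : 0 < v i := by simpa using hi
  have hposR : ∀ j ∈ reach i, 0 < v j := by
    intro j hj
    rcases ((hmem i j).1 hj).cases_tail with rfl | ⟨_, _, hbc⟩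
    exacts [hi, hbc.2.1]
  have hReq : ∀ j ∈ reach i, reach j = reach i := by
    intro j hj
    refine Finset.eq_of_subset_of_card_le (fun k hk => ?_)
      (hmin j (by simpa using hposR j hj))
    exact (hmem i k).2 (((hmem i j).1 hj).trans ((hmem j k).1 hk))
  have hconn : IsStronglyConnected P (reach i) := by
    refine ⟨⟨i, (hmem i i).2 .refl⟩, fun x hx y hy => ⟨hx, hy, ?_⟩⟩
    have hxy : Relation.ReflTransGen E x y := by rwa [← hmem, hReq x hx]
    clear hy
    induction hxy with
    | refl => exact .refl
    | @tail b c hb hbc ih =>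
      have hbR : b ∈ reach i := by rwa [← hReq x hx, hmem]
      have hcR : c ∈ reach i := by rw [← hReq x hx, hmem]; exact hb.tail hbc
      exact ih.tail ⟨hbR, hcR, hbc.2.2⟩
  have hRZ : reach i ⊆ Z := fun j hj => by
    by_contra h
    have := hposR j hj
    rw [hv0 j h] at this
    exact this.false
  -- An entry outside `reach i` that contributed to the sum would itself be reachable.
  have hsub : IsSubVec a (reach i) 1 v := by
    refine ⟨hv.1, ⟨i, (hmem i i).2 .refl, hi⟩, fun x hx => (hv.2.2 x (hRZ hx)).trans_eq ?_⟩
    refine (Finset.sum_subset hRZ fun y _ hy => ?_).symm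
    by_contra hne
    have hpos : 0 < a x y * v y := (mul_nonneg (ha x y) (hv.1 y)).lt_of_ne' hne
    have hvy := pos_of_mul_pos_right hpos (ha x y)
    have hay := pos_of_mul_pos_left hpos (hv.1 y)
    exact hy ((hmem i y).2 (((hmem i x).1 hx).tail ⟨hposR x hx, hvy, hP x y hay⟩))
  obtain ⟨H, hRH, hH⟩ := hconn.exists_isSCComponent
  refine ⟨H, hH, le_antisymm ((blockRadius_mono ha (Finset.subset_univ H)).trans huniv) ?_,
    i, hRH ((hmem i i).2 .refl), hRZ ((hmem i i).2 .refl)⟩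
  exact le_trans (by simpa using hsub.le_blockRadius ha) (blockRadius_mono ha hRH)

end StronglyConnected

end MarkovQuantization

/-! ### Cut words and the renewal equation for their number. -/

section CutWords

variable {ι : Type*} [Fintype ι] [DecidableEq ι]

/-- The words starting at `i` which are cut as soon as the product of the entries of `h` along
the word falls below `ε`; words longer than `n + 1` are cut as well. -/
noncomputable def cutWords (h : Matrix ι ι ℝ) : ℕ → ι → ℝ → Finset (List ι)
  | 0, i, _ => {[i]}
  | n + 1, i, ε => if 1 < ε then {[i]} else
      (Finset.univ.filter fun j => 0 < h i j).biUnion fun j =>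
        (cutWords h n j (ε / h i j)).image (List.cons i)

theorem cutWords_of_one_lt (h : Matrix ι ι ℝ) (n : ℕ) (i : ι) {ε : ℝ} (hε : 1 < ε) :
    cutWords h n i ε = {[i]} := by
  cases n <;> simp [cutWords, hε]

theorem mem_cutWords_succ {h : Matrix ι ι ℝ} {n : ℕ} {i : ι} {ε : ℝ} (hε : ε ≤ 1) {σ : List ι} :
    σ ∈ cutWords h (n + 1) i ε ↔
      ∃ j, 0 < h i j ∧ ∃ τ ∈ cutWords h n j (ε / h i j), σ = i :: τ := by
  simp [cutWords, not_lt.2 hε, eq_comm]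

theorem exists_eq_cons_of_mem_cutWords {h : Matrix ι ι ℝ} {n : ℕ} {i : ι} {ε : ℝ} {σ : List ι}
    (hσ : σ ∈ cutWords h n i ε) : ∃ τ, σ = i :: τ := by
  rcases n with _ | n
  · exact ⟨[], by simpa [cutWords] using hσ⟩
  · rcases lt_or_ge 1 ε with hε | hε
    · exact ⟨[], by simpa [cutWords_of_one_lt h _ i hε] using hσ⟩
    · obtain ⟨j, _, τ, _, rfl⟩ := (mem_cutWords_succ hε).1 hσ
      exact ⟨τ, rfl⟩

theorem card_cutWords_succ (h : Matrix ι ι ℝ) (n : ℕ) (i : ι) {ε : ℝ} (hε : ε ≤ 1) :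
    (cutWords h (n + 1) i ε).card =
      ∑ j ∈ Finset.univ.filter fun j => 0 < h i j, (cutWords h n j (ε / h i j)).card := by
  rw [cutWords, if_neg (not_lt.2 hε), Finset.card_biUnion]
  · exact Finset.sum_congr rfl fun j _ => Finset.card_image_of_injective _ (List.cons_injective)
  · intro j _ k _ hjk
    rw [Function.onFun, Finset.disjoint_left]
    simp only [Finset.mem_image, not_exists, not_and]
    rintro _ ⟨τ, hτ, rfl⟩ τ' hτ' heq
    obtain rfl := List.cons_injective heq
    obtain ⟨τ₁, rfl⟩ := exists_eq_cons_of_mem_cutWords hτ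
    obtain ⟨τ₂, h2⟩ := exists_eq_cons_of_mem_cutWords hτ'
    exact hjk (List.cons.inj h2).1

/-- The normalised number `ε ^ θ * card` of cut words starting at `i`. -/
noncomputable def normCount (h : Matrix ι ι ℝ) (θ : ℝ) (n : ℕ) (i : ι) (ε : ℝ) : ℝ :=
  ε ^ θ * (cutWords h n i ε).card

theorem normCount_nonneg (h : Matrix ι ι ℝ) (θ : ℝ) (n : ℕ) (i : ι) {ε : ℝ} (hε : 0 < ε) :
    0 ≤ normCount h θ n i ε :=
  mul_nonneg (Real.rpow_nonneg hε.le _) (Nat.cast_nonneg _)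

theorem normCount_of_one_lt (h : Matrix ι ι ℝ) (θ : ℝ) (n : ℕ) (i : ι) {ε : ℝ} (hε : 1 < ε) :
    normCount h θ n i ε = ε ^ θ := by
  simp [normCount, cutWords_of_one_lt h n i hε]

variable {h : Matrix ι ι ℝ} {η ρ θ : ℝ}

/-- The renewal equation: the factor h_ij^θ rescales ε / h_ij back to ε. -/
theorem HasBounds.normCount_succ (hb : HasBounds h η ρ) (hθ : 0 < θ) (n : ℕ) (i : ι) {ε : ℝ}
    (hε0 : 0 < ε) (hε : ε ≤ 1) :
    normCount h θ (n + 1) i ε = ∑ j, powMatrix h θ i j * normCount h θ n j (ε / h i j) := by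
  rw [normCount, card_cutWords_succ h n i hε, Nat.cast_sum, Finset.mul_sum, Finset.sum_filter]
  refine Finset.sum_congr rfl fun j _ => ?_
  split_ifs with hij
  · rw [normCount, powMatrix_apply, ← mul_assoc, ← Real.mul_rpow hij.le (by positivity),
      mul_div_cancel₀ _ hij.ne']
  · rw [powMatrix_apply, ← (hb.nonneg i j).eq_of_not_lt hij, Real.zero_rpow hθ.ne', zero_mul]

/-- Comparison with a supersolution g. The condition ρ^n < ε ensures that the depth n is not
exhausted before the words are cut. Since ε / h_ij ≤ η⁻¹ for ε ≤ 1, boundary values are needed only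
on (1, η⁻¹]. -/
theorem HasBounds.normCount_le (hb : HasBounds h η ρ) (hθ : 0 < θ) {g : ι → ℝ → ℝ}
    (hg : ∀ i ε, 1 < ε → ε ≤ η⁻¹ → ε ^ θ ≤ g i ε)
    (hsup : ∀ i ε, 0 < ε → ε ≤ 1 → ∑ j, powMatrix h θ i j * g j (ε / h i j) ≤ g i ε)
    (n : ℕ) (i : ι) (ε : ℝ) (hε : ρ ^ n < ε) (hεη : ε ≤ η⁻¹) :
    normCount h θ n i ε ≤ g i ε := by
  induction n generalizing i ε with
  | zero =>
    have h1 : 1 < ε := by simpa using hε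
    rw [normCount_of_one_lt h θ 0 i h1]
    exact hg i ε h1 hεη
  | succ n ih =>
    rcases lt_or_ge 1 ε with h1 | h1
    · rw [normCount_of_one_lt h θ _ i h1]
      exact hg i ε h1 hεη
    · have hε0 : 0 < ε := (pow_pos hb.rho_pos _).trans hε
      rw [hb.normCount_succ hθ n i hε0 h1]
      refine le_trans (Finset.sum_le_sum fun j _ => ?_) (hsup i ε hε0 h1)
      rcases (hb.nonneg i j).eq_or_lt with hij | hij
      · simp [powMatrix_apply, ← hij, Real.zero_rpow hθ.ne']
      · refine mul_le_mul_of_nonneg_left (ih j _ (hb.pow_lt_div hε hij) ?_)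
          (hb.powMatrix_nonneg θ i j)
        exact hb.div_le hε0 (by rwa [mul_inv_cancel₀ hb.pos.ne']) hij

theorem HasBounds.le_normCount (hb : HasBounds h η ρ) (hθ : 0 < θ) {v : ι → ℝ}
    (hv1 : ∀ i, v i ≤ 1) (hv : ∀ i, v i ≤ ∑ j, powMatrix h θ i j * v j)
    (n : ℕ) (i : ι) (ε : ℝ) (hε : ρ ^ n < ε) : v i ≤ normCount h θ n i ε := by
  have hlt : ∀ n i ε, (1 : ℝ) < ε → v i ≤ normCount h θ n i ε := fun n i ε h1 => by
    rw [normCount_of_one_lt h θ n i h1]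
    exact (hv1 i).trans (Real.one_le_rpow h1.le hθ.le)
  induction n generalizing i ε with
  | zero => exact hlt 0 i ε (by simpa using hε)
  | succ n ih =>
    rcases lt_or_ge 1 ε with h1 | h1
    · exact hlt _ i ε h1
    · have hε0 : 0 < ε := (pow_pos hb.rho_pos _).trans hε
      rw [hb.normCount_succ hθ n i hε0 h1]
      refine (hv i).trans (Finset.sum_le_sum fun j _ => ?_)
      rcases (hb.nonneg i j).eq_or_lt with hij | hij
      · simp [powMatrix_apply, ← hij, Real.zero_rpow hθ.ne']
      · exact mul_le_mul_of_nonneg_left (ih j _ (hb.pow_lt_div hε hij))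
          (hb.powMatrix_nonneg θ i j)

/-- A lower bound valid below level x improves by one application of the matrix, at the price of
restricting to levels below ηx. Iteration gives the divergence in `le_normCount_of_precedes`. -/
theorem HasBounds.sum_le_normCount (hb : HasBounds h η ρ) (hθ : 0 < θ) {f : ι → ℝ} {x : ℝ}
    (hx : η * x ≤ 1) (hf : ∀ n i ε, ρ ^ n < ε → ε ≤ x → f i ≤ normCount h θ n i ε)
    (n : ℕ) (i : ι) (ε : ℝ) (hε : ρ ^ n < ε) (hεx : ε ≤ η * x) :
    ∑ j, powMatrix h θ i j * f j ≤ normCount h θ n i ε := by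
  have hε0 : 0 < ε := (pow_pos hb.rho_pos _).trans hε
  rcases n with _ | n
  · rw [pow_zero] at hε
    linarith
  · rw [hb.normCount_succ hθ n i hε0 (hεx.trans hx)]
    refine Finset.sum_le_sum fun j _ => ?_
    rcases (hb.nonneg i j).eq_or_lt with hij | hij
    · simp [powMatrix_apply, ← hij, Real.zero_rpow hθ.ne']
    · exact mul_le_mul_of_nonneg_left
        (hf n j _ (hb.pow_lt_div hε hij) (hb.div_le hε0 hεx hij)) (hb.powMatrix_nonneg θ i j)

end CutWords

/-! ### Bounds for the normalised counts. -/

section Asymptotics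

theorem exists_forall_le_mul {ι : Type*} [Finite ι] (x : ι → ℝ) {y : ι → ℝ} (hy : ∀ i, 0 < y i) (m : ℝ) :
    ∃ K, m ≤ K ∧ ∀ i, x i ≤ K * y i := by
  have : ∀ᶠ K in atTop, ∀ i, x i ≤ K * y i := by
    rw [eventually_all]
    exact fun i => (tendsto_id.atTop_mul_const (hy i)).eventually_ge_atTop (x i)
  exact ((eventually_ge_atTop m).and this).exists

variable {ι : Type*} [Fintype ι] [DecidableEq ι] {h : Matrix ι ι ℝ} {η ρ θ : ℝ}

theorem HasBounds.exists_le_normCount (hb : HasBounds h η ρ) (hθ : 0 < θ)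
    (h1 : 1 ≤ blockRadius (powMatrix h θ) Finset.univ) :
    ∃ b > 0, ∀ n ε, ρ ^ n < ε → b ≤ ∑ i, normCount h θ n i ε := by
  obtain ⟨v, hv, -⟩ := exists_isSubVec (hb.powMatrix_nonneg θ) one_pos (by simpa using h1)
  obtain ⟨K, hK, hle⟩ := exists_forall_le_mul v (fun _ => one_pos) 1
  obtain ⟨i, _, hi⟩ := hv.2.1
  have hK0 : 0 < K := by linarith
  refine ⟨K⁻¹ * v i, by positivity, fun n ε hε => ?_⟩
  have hε0 : 0 < ε := (pow_pos hb.rho_pos _).trans hε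
  have h2 := hb.le_normCount hθ (v := fun i => K⁻¹ * v i) (fun i => by
    rw [inv_mul_le_iff₀ hK0]; simpa using hle i) (fun i => by
    have h3 := hv.2.2 i (Finset.mem_univ _)
    calc K⁻¹ * v i ≤ K⁻¹ * ∑ j, powMatrix h θ i j * v j := by
          gcongr; linarith
      _ = _ := by rw [Finset.mul_sum]; exact Finset.sum_congr rfl fun j _ => by ring) n i ε hε
  exact h2.trans (Finset.single_le_sum (f := fun i => normCount h θ n i ε)
    (fun j _ => normCount_nonneg h θ n j hε0) (Finset.mem_univ i))

/-- C carries the critical components, D lies downstream of C, and U denotes the remaining vertices.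
The supersolution is B α + ε^δ β with α = v + M u 1_U and β = K u 1_D - κ v. On D the block is
subcritical with room to spare, so the counts decay like ε^δ. On C the equation a v = v leaves no
room for the contribution of D, and the term -κ ε^δ v creates it, because dividing by h^δ enlarges a
v by the factor ρ^(-δ) > 1 at least. On U the margin 1 - q absorbs the rest once M is large. -/
theorem HasBounds.normCount_bounded (hb : HasBounds h η ρ) (hθ : 0 < θ) {C D : Finset ι}
    (hCD : Disjoint C D) (hC : ∀ i ∈ C, ∀ j, 0 < h i j → j ∈ C ∨ j ∈ D)
    (hD : ∀ i ∈ D, ∀ j, 0 < h i j → j ∈ D) {v u : ι → ℝ} (hvC : ∀ i ∈ C, 0 < v i)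
    (hv0 : ∀ i ∉ C, v i = 0) (hv : ∀ i ∈ C, ∑ j, powMatrix h θ i j * v j = v i) {q : ℝ}
    (hq : q < 1) (hu : IsSupVec (powMatrix h θ) Cᶜ q u) :
    ∃ B, ∀ n i ε, ρ ^ n < ε → ε ≤ η⁻¹ → normCount h θ n i ε ≤ B := by
  set a := powMatrix h θ with ha
  have ha0 : ∀ i j, 0 ≤ a i j := hb.powMatrix_nonneg θ
  have hazero : ∀ i j, ¬ 0 < h i j → a i j = 0 := fun i j hij => by
    rw [ha, powMatrix_apply, ← (hb.nonneg i j).eq_of_not_lt hij, Real.zero_rpow hθ.ne']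
  have hvnn : ∀ i, 0 ≤ v i := fun i => by
    by_cases hi : i ∈ C
    exacts [(hvC i hi).le, (hv0 i hi).ge]
  -- δ is so small that q < η^δ; hence the block off C stays subcritical after division by h^δ.
  obtain ⟨δ₀, hδ₀, hlt⟩ := exists_lt_rpow hb.pos hq
  set δ := δ₀ / 2 with hδdef
  have hδ : 0 < δ := by positivity
  have hqδ : q < η ^ δ := hlt δ hδ.le (by linarith)
  have hηδ : 0 < η ^ δ := Real.rpow_pos_of_pos hb.pos _
  have hρδ : ρ ^ δ < 1 := Real.rpow_lt_one hb.rho_pos.le hb.rho_lt_one hδ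
  have hρδ0 : 0 < ρ ^ δ := Real.rpow_pos_of_pos hb.rho_pos _
  -- The term (ε / h_ij)^δ of the supersolution replaces the weights a by b = a h^(-δ).
  set b : ι → ι → ℝ := fun i j => a i j * (h i j ^ δ)⁻¹ with hbdef
  have hb0 : ∀ i j, 0 ≤ b i j := fun i j =>
    mul_nonneg (ha0 i j) (inv_nonneg.2 (Real.rpow_nonneg (hb.nonneg i j) _))
  have hbzero : ∀ i j, ¬ 0 < h i j → b i j = 0 := fun i j hij => by
    simp only [hbdef, hazero i j hij, zero_mul]
  have hble : ∀ i j, b i j ≤ (η ^ δ)⁻¹ * a i j := by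
    intro i j
    by_cases hij : 0 < h i j
    · rw [mul_comm]
      refine mul_le_mul_of_nonneg_left (inv_anti₀ hηδ ?_) (ha0 i j)
      exact Real.rpow_le_rpow hb.pos.le (hb.eta_le i j hij) hδ.le
    · rw [hbzero i j hij, hazero i j hij, mul_zero]
  have hleb : ∀ i j, (ρ ^ δ)⁻¹ * a i j ≤ b i j := by
    intro i j
    by_cases hij : 0 < h i j
    · rw [mul_comm]
      refine mul_le_mul_of_nonneg_left (inv_anti₀ (Real.rpow_pos_of_pos hij _) ?_) (ha0 i j)
      exact Real.rpow_le_rpow hij.le (hb.le_rho i j) hδ.le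
    · rw [hbzero i j hij, hazero i j hij, mul_zero]
  set uD : ι → ℝ := fun i => if i ∈ D then u i else 0 with huD
  set uU : ι → ℝ := fun i => if i ∈ C ∪ D then 0 else u i with huU
  have huD0 : ∀ i, 0 ≤ uD i := fun i => by
    simp only [huD]; split_ifs; exacts [(hu.1 i).le, le_rfl]
  have hsumZ : ∀ i ∉ C, ∑ j, a i j * uD j + ∑ j, a i j * uU j ≤ q * u i := by
    intro i hi
    rw [← Finset.sum_add_distrib]
    refine le_trans (le_of_eq ?_) (hu.2 i (by simpa using hi))
    rw [← Finset.sum_add_sum_compl C]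
    have hz : ∑ j ∈ C, (a i j * uD j + a i j * uU j) = 0 := Finset.sum_eq_zero fun j hj => by
      simp [huD, huU, hj, Finset.disjoint_left.1 hCD hj]
    rw [hz, zero_add]
    refine Finset.sum_congr rfl fun j hj => ?_
    have hj' : j ∉ C := by simpa using hj
    by_cases hjD : j ∈ D <;> simp [huD, huU, hj', hjD]
  set c₀ : ℝ := (η⁻¹) ^ θ with hc₀
  -- The constants are chosen in this order: K for the boundary values on D, κ to compensate the
  -- contribution of D on C, M for the inequality on U, and B for the remaining boundary values.
  obtain ⟨K, hK1, hK⟩ := exists_forall_le_mul (fun _ => c₀) hu.1 1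
  have hγ : 0 < (ρ ^ δ)⁻¹ - 1 := by
    rw [sub_pos]; exact (one_lt_inv₀ hρδ0).2 hρδ
  obtain ⟨κ, hκ1, hκ⟩ := exists_forall_le_mul (fun i => if i ∈ C then K * ∑ j, b i j * uD j else 0)
    (y := fun i => if i ∈ C then ((ρ ^ δ)⁻¹ - 1) * v i else 1) (fun i => by
      split_ifs with hi
      exacts [mul_pos hγ (hvC i hi), one_pos]) 1
  obtain ⟨M, hM1, hM⟩ := exists_forall_le_mul
    (fun i => ∑ j, a i j * v j + K * ∑ j, b i j * uD j)
    (y := fun i => (1 - q) * u i) (fun i => mul_pos (by linarith) (hu.1 i)) 1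
  obtain ⟨B, hB1, hB⟩ := exists_forall_le_mul
    (fun i => if i ∈ C then c₀ + κ * v i * (η⁻¹) ^ δ else c₀)
    (y := fun i => if i ∈ C then v i else M * u i) (fun i => by
      split_ifs with hi
      exacts [hvC i hi, mul_pos (by linarith) (hu.1 i)]) 1
  set α : ι → ℝ := fun i => v i + M * uU i with hα
  set β : ι → ℝ := fun i => K * uD i - κ * v i with hβ
  have hsumα : ∀ i, ∑ j, a i j * α j = ∑ j, a i j * v j + M * ∑ j, a i j * uU j := fun i => by
    rw [Finset.mul_sum, ← Finset.sum_add_distrib]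
    exact Finset.sum_congr rfl fun j _ => by simp only [hα]; ring
  have hsumβ : ∀ i, ∑ j, b i j * β j = K * ∑ j, b i j * uD j - κ * ∑ j, b i j * v j := fun i => by
    rw [Finset.mul_sum, Finset.mul_sum, ← Finset.sum_sub_distrib]
    exact Finset.sum_congr rfl fun j _ => by simp only [hβ]; ring
  have hbv0 : ∀ i, 0 ≤ ∑ j, b i j * v j := fun i =>
    Finset.sum_nonneg fun j _ => mul_nonneg (hb0 i j) (hvnn j)
  have hbD0 : ∀ i, 0 ≤ ∑ j, b i j * uD j := fun i =>
    Finset.sum_nonneg fun j _ => mul_nonneg (hb0 i j) (huD0 j)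
  have hK0 : 0 < K := by linarith
  have hκ0 : 0 < κ := by linarith
  have hM0 : 0 < M := by linarith
  have hB0 : 0 < B := by linarith
  have hαβ : ∀ i, ∀ x : ℝ, 0 ≤ x → x ≤ 1 →
      B * ∑ j, a i j * α j + x * ∑ j, b i j * β j ≤ B * α i + x * β i := by
    intro i x hx hx1
    by_cases hiC : i ∈ C
    · have h1 : ∑ j, a i j * uU j = 0 := Finset.sum_eq_zero fun j _ => by
        by_cases hij : 0 < h i j
        · simp [huU, hC i hiC j hij]
        · rw [hazero i j hij, zero_mul]
      have hiD := Finset.disjoint_left.1 hCD hiC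
      have h2 : α i = v i := by simp [hα, huU, hiC]
      have h3 : β i = -(κ * v i) := by simp [hβ, huD, hiD]
      rw [hsumα, h1, hv i hiC, h2, h3, hsumβ, mul_zero, add_zero]
      have h4 := hκ i
      simp only [if_pos hiC] at h4
      have h5 : (ρ ^ δ)⁻¹ * v i ≤ ∑ j, b i j * v j := by
        rw [← hv i hiC, Finset.mul_sum]
        exact Finset.sum_le_sum fun j _ => by
          rw [← mul_assoc]; exact mul_le_mul_of_nonneg_right (hleb i j) (hvnn j)
      have h6 := mul_le_mul_of_nonneg_left h5 hκ0.le
      have h7 : K * ∑ j, b i j * uD j - κ * ∑ j, b i j * v j ≤ -(κ * v i) := by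
        linarith
      linarith [mul_le_mul_of_nonneg_left h7 hx]
    · by_cases hiD : i ∈ D
      · have h1 : ∑ j, a i j * uU j = 0 := Finset.sum_eq_zero fun j _ => by
          by_cases hij : 0 < h i j
          · simp [huU, hD i hiD j hij]
          · rw [hazero i j hij, zero_mul]
        have h2 : ∀ b' : ι → ι → ℝ, (∀ j, ¬ 0 < h i j → b' i j = 0) →
            ∑ j, b' i j * v j = 0 := fun b' hb' => Finset.sum_eq_zero fun j _ => by
          by_cases hij : 0 < h i j
          · rw [hv0 j fun hjC => Finset.disjoint_left.1 hCD hjC (hD i hiD j hij), mul_zero]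
          · rw [hb' j hij, zero_mul]
        rw [hsumα, h1, h2 a (hazero i), hsumβ, h2 b (hbzero i)]
        have h3 : α i = 0 := by simp [hα, huU, hiD, hv0 i hiC]
        have h4 : β i = K * u i := by simp [hβ, huD, hiD, hv0 i hiC]
        have h5 : ∑ j, b i j * uD j ≤ u i := by
          have h6 : ∑ j, b i j * uD j ≤ (η ^ δ)⁻¹ * ∑ j, a i j * uD j := by
            rw [Finset.mul_sum]
            exact Finset.sum_le_sum fun j _ => by
              rw [← mul_assoc]; exact mul_le_mul_of_nonneg_right (hble i j) (huD0 j)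
          have h7 := hsumZ i hiC
          rw [h1, add_zero] at h7
          have h8 : q * u i ≤ η ^ δ * u i := mul_le_mul_of_nonneg_right hqδ.le (hu.1 i).le
          refine h6.trans ?_
          rw [inv_mul_le_iff₀ hηδ]
          linarith
        rw [h3, h4]
        have h9 := mul_le_mul_of_nonneg_left (mul_le_mul_of_nonneg_left h5 hK0.le) hx
        linarith
      · have h1 : α i = M * u i := by simp [hα, huU, hiC, hiD, hv0 i hiC]
        have h2 : β i = 0 := by simp [hβ, huD, hiD, hv0 i hiC]
        rw [hsumα, hsumβ, h1, h2]
        have h3 := hM i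
        have h4 := hsumZ i hiC
        have h5 : 0 ≤ ∑ j, a i j * uD j :=
          Finset.sum_nonneg fun j _ => mul_nonneg (ha0 i j) (huD0 j)
        have h6 : M * ∑ j, a i j * uU j ≤ M * (q * u i) :=
          mul_le_mul_of_nonneg_left (by linarith) hM0.le
        have h7 : x * (K * ∑ j, b i j * uD j - κ * ∑ j, b i j * v j) ≤
            K * ∑ j, b i j * uD j := by
          have h8 : 0 ≤ K * ∑ j, b i j * uD j := mul_nonneg hK0.le (hbD0 i)
          have h9 : 0 ≤ κ * ∑ j, b i j * v j := mul_nonneg hκ0.le (hbv0 i)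
          nlinarith
        have h8 : 0 ≤ K * ∑ j, b i j * uD j := mul_nonneg hK0.le (hbD0 i)
        have h9 : K * ∑ j, b i j * uD j ≤ B * (K * ∑ j, b i j * uD j) :=
          le_mul_of_one_le_left h8 hB1
        have h10 : B * (∑ j, a i j * v j + M * ∑ j, a i j * uU j) +
            B * (K * ∑ j, b i j * uD j) ≤ B * (M * u i) := by
          rw [← mul_add]
          refine mul_le_mul_of_nonneg_left ?_ hB0.le
          linarith
        linarith
  have hfin : ∀ n i ε, ρ ^ n < ε → ε ≤ η⁻¹ →
      normCount h θ n i ε ≤ B * α i + ε ^ δ * β i := by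
    refine hb.normCount_le hθ (g := fun i ε => B * α i + ε ^ δ * β i) ?_ ?_
    · intro i ε h1 hε
      have hε0 : 0 < ε := by linarith
      have h2 : ε ^ θ ≤ c₀ := Real.rpow_le_rpow hε0.le hε hθ.le
      have h3 : ε ^ δ ≤ η⁻¹ ^ δ := Real.rpow_le_rpow hε0.le hε hδ.le
      have h4 : 1 ≤ ε ^ δ := Real.one_le_rpow h1.le hδ.le
      refine h2.trans ?_
      have h5 := hB i
      by_cases hiC : i ∈ C
      · have hiD := Finset.disjoint_left.1 hCD hiC
        have h6 : α i = v i := by simp [hα, huU, hiC]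
        have h7 : β i = -(κ * v i) := by simp [hβ, huD, hiD]
        simp only [if_pos hiC] at h5
        rw [h6, h7]
        have h8 := mul_le_mul_of_nonneg_left h3 (mul_nonneg hκ0.le (hvC i hiC).le)
        linarith
      · by_cases hiD : i ∈ D
        · have h6 : α i = 0 := by simp [hα, huU, hiD, hv0 i hiC]
          have h7 : β i = K * u i := by simp [hβ, huD, hiD, hv0 i hiC]
          rw [h6, h7, mul_zero, zero_add]
          refine (hK i).trans (le_mul_of_one_le_left ?_ h4)
          exact mul_nonneg hK0.le (hu.1 i).le
        · have h6 : α i = M * u i := by simp [hα, huU, hiC, hiD, hv0 i hiC]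
          have h7 : β i = 0 := by simp [hβ, huD, hiD, hv0 i hiC]
          simp only [if_neg hiC] at h5
          rw [h6, h7, mul_zero, add_zero]
          exact h5
    · intro i ε hε0 hε1
      refine le_trans (le_of_eq ?_) (hαβ i (ε ^ δ) (Real.rpow_nonneg hε0.le _)
        (Real.rpow_le_one hε0.le hε1 hδ.le))
      rw [Finset.mul_sum, Finset.mul_sum, ← Finset.sum_add_distrib]
      refine Finset.sum_congr rfl fun j _ => ?_
      rw [Real.div_rpow hε0.le (hb.nonneg i j)]
      simp only [hbdef]
      ring
  obtain ⟨T, -, hT⟩ := exists_forall_le_mul (fun i => B * α i + (η⁻¹) ^ δ * |β i|)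
    (fun _ => one_pos) 0
  refine ⟨T, fun n i ε hε hεη => (hfin n i ε hε hεη).trans (le_trans ?_ (hT i |>.trans_eq
    (mul_one T)))⟩
  have hε0 : 0 < ε := (pow_pos hb.rho_pos _).trans hε
  have h3 : ε ^ δ ≤ η⁻¹ ^ δ := Real.rpow_le_rpow hε0.le hεη hδ.le
  have h4 : 0 ≤ ε ^ δ := Real.rpow_nonneg hε0.le _
  have h5 : ε ^ δ * β i ≤ ε ^ δ * |β i| := mul_le_mul_of_nonneg_left (le_abs_self _) h4
  have h6 : ε ^ δ * |β i| ≤ η⁻¹ ^ δ * |β i| := mul_le_mul_of_nonneg_right h3 (abs_nonneg _)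
  linarith

theorem HasBounds.normCount_bounded_of_blockRadius_lt_one (hb : HasBounds h η ρ) (hθ : 0 < θ)
    (h1 : blockRadius (powMatrix h θ) Finset.univ < 1) :
    ∃ B, ∀ n i ε, ρ ^ n < ε → ε ≤ η⁻¹ → normCount h θ n i ε ≤ B := by
  obtain ⟨q, hq0, hq1, hq2⟩ := ENNReal.lt_iff_exists_real_btwn.1 h1
  have hq : 0 < q := by
    by_contra! h
    rw [ENNReal.ofReal_of_nonpos h] at hq1
    exact absurd hq1 (by simp)
  obtain ⟨u, hu⟩ := exists_isSupVec (hb.powMatrix_nonneg θ) hq hq1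
  -- With no critical vertices the supervector lives on the whole index set.
  exact hb.normCount_bounded hθ (C := ∅) (D := ∅) (v := 0) (by simp) (by simp) (by simp) (by simp)
    (by simp) (by simp) (ENNReal.ofReal_lt_one.1 hq2) (by simpa using hu)

end Asymptotics

namespace MarkovQuantization

/-! ### Incomparable versus comparable critical components. -/

section CriticalComponents

variable {N : ℕ} {P h : Matrix (Fin N) (Fin N) ℝ} {η ρ θ : ℝ}

theorem PathIn.refl_univ (i : Fin N) : PathIn P Finset.univ i i :=
  ⟨Finset.mem_univ _, Finset.mem_univ _, .refl⟩

theorem PathIn.univ_of_pos {i j : Fin N} (hij : 0 < P i j) : PathIn P Finset.univ i j :=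
  ⟨Finset.mem_univ _, Finset.mem_univ _, .single ⟨Finset.mem_univ _, Finset.mem_univ _, hij⟩⟩

-- The vertices mutually reachable with x form a strongly connected set containing H, so by
-- maximality they are H.
open Classical in
theorem IsSCComponent.mem_of_pathIn {H : Finset (Fin N)} (hH : IsSCComponent P H) {x y i : Fin N}
    (hx : x ∈ H) (hy : y ∈ H) (hxi : PathIn P Finset.univ x i) (hiy : PathIn P Finset.univ i y) :
    i ∈ H := by
  have hyx : PathIn P Finset.univ y x := (hH.1.2 y hy x hx).mono (Finset.subset_univ _)
  set H' : Finset (Fin N) := Finset.univ.filter fun z =>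
    PathIn P Finset.univ x z ∧ PathIn P Finset.univ z x with hH'
  have hmem : ∀ z, z ∈ H' ↔ PathIn P Finset.univ x z ∧ PathIn P Finset.univ z x := fun z => by
    simp [hH']
  have hconn : IsStronglyConnected P H' := by
    refine ⟨⟨x, (hmem x).2 ⟨.refl_univ x, .refl_univ x⟩⟩, fun z hz w hw => ⟨hz, hw, ?_⟩⟩
    have hzw := (((hmem z).1 hz).2.trans ((hmem w).1 hw).1).2.2
    clear hxi hiy
    induction hzw using Relation.ReflTransGen.head_induction_on with
    | refl => exact .refl
    | @head z z' hzz' hrest ih =>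
      have hz' : z' ∈ H' := (hmem z').2 ⟨((hmem z).1 hz).1.trans (.univ_of_pos hzz'.2.2),
        PathIn.trans ⟨Finset.mem_univ _, Finset.mem_univ _, hrest⟩ ((hmem w).1 hw).2⟩
      exact (ih hz').head ⟨hz, hz', hzz'.2.2⟩
  have hsub : H ⊆ H' := fun z hz => (hmem z).2
    ⟨(hH.1.2 x hx z hz).mono (Finset.subset_univ _), (hH.1.2 z hz x hx).mono (Finset.subset_univ _)⟩
  rw [hH.eq_of_le hconn hsub, hmem]
  exact ⟨hxi, hiy.trans hyx⟩

/-- The strongly connected components on which the weights `h ^ θ` have spectral radius one. -/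
def unitComponents (P h : Matrix (Fin N) (Fin N) ℝ) (θ : ℝ) : Set (Finset (Fin N)) :=
  {H | IsSCComponent P H ∧ blockRadius (powMatrix h θ) H = 1}

theorem exists_harmonic (hb : HasBounds h η ρ) (hθ : 0 < θ) (hP : ∀ i j, 0 < P i j ↔ 0 < h i j)
    {H : Finset (Fin N)} (hH : H ∈ unitComponents P h θ) :
    ∃ f : Fin N → ℝ, (∀ i ∈ H, 0 < f i) ∧ ∀ i ∈ H, ∑ j ∈ H, powMatrix h θ i j * f j = f i := by
  have ha := hb.powMatrix_nonneg θ
  have hPa : ∀ i j, 0 < P i j → 0 < powMatrix h θ i j := fun i j hij =>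
    (hb.powMatrix_pos_iff hθ i j).2 ((hP i j).1 hij)
  obtain ⟨f, -, hf, hle⟩ := hH.1.1.exists_pos_le ha hPa hH.2.le
  obtain ⟨v, hv, -⟩ := exists_isSubVec ha one_pos (by simpa using hH.2.ge)
  exact ⟨f, hf, fun i hi => (hH.1.1.eq_of_isSubVec ha hPa hf hv (e := 0) (fun _ _ => le_rfl)
    (fun i hi => by simpa using hle i hi) i hi).2⟩

-- Here C is the union of the critical components, D the vertices outside C reachable from C, and v
-- is patched from their harmonic vectors. Incomparability ensures that D never returns to C and
-- that no edge joins two critical components. Off C the radius is below one, as otherwise a further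
-- critical component would meet the complement.
open Classical in
theorem normCount_bounded_of_pairwise (hb : HasBounds h η ρ) (hθ : 0 < θ)
    (hP : ∀ i j, 0 < P i j ↔ 0 < h i j) (h1 : blockRadius (powMatrix h θ) Finset.univ = 1)
    (hpw : (unitComponents P h θ).Pairwise (Incomparable P)) :
    ∃ B, ∀ n i ε, ρ ^ n < ε → ε ≤ η⁻¹ → normCount h θ n i ε ≤ B := by
  have ha := hb.powMatrix_nonneg θ
  have huniq : ∀ H ∈ unitComponents P h θ, ∀ H' ∈ unitComponents P h θ, ∀ i ∈ H, ∀ j ∈ H',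
      PathIn P Finset.univ i j → H = H' := by
    intro H hH H' hH' i hi j hj hij
    by_contra hne
    exact (hpw hH hH' hne).1 ⟨i, hi, j, hj, hij⟩
  have hharm : ∀ H : Finset (Fin N), ∃ f : Fin N → ℝ, H ∈ unitComponents P h θ →
      (∀ i ∈ H, 0 < f i) ∧ ∀ i ∈ H, ∑ j ∈ H, powMatrix h θ i j * f j = f i := by
    intro H
    by_cases hH : H ∈ unitComponents P h θ
    · obtain ⟨f, hf⟩ := exists_harmonic hb hθ hP hH
      exact ⟨f, fun _ => hf⟩
    · exact ⟨0, fun h => absurd h hH⟩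
  choose F hF using hharm
  set C : Finset (Fin N) := Finset.univ.filter fun i => ∃ H ∈ unitComponents P h θ, i ∈ H with hC
  have hCmem : ∀ i, i ∈ C ↔ ∃ H ∈ unitComponents P h θ, i ∈ H := fun i => by simp [hC]
  set D : Finset (Fin N) := Finset.univ.filter fun j =>
    j ∉ C ∧ ∃ i ∈ C, PathIn P Finset.univ i j with hD
  have hDmem : ∀ j, j ∈ D ↔ j ∉ C ∧ ∃ i ∈ C, PathIn P Finset.univ i j := fun i => by simp [hD]
  set v : Fin N → ℝ := fun i =>
    if hi : ∃ H ∈ unitComponents P h θ, i ∈ H then F hi.choose i else 0 with hv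
  have hvH : ∀ H ∈ unitComponents P h θ, ∀ i ∈ H, v i = F H i := by
    intro H hH i hi
    have hex : ∃ H ∈ unitComponents P h θ, i ∈ H := ⟨H, hH, hi⟩
    have : hex.choose = H := huniq _ hex.choose_spec.1 _ hH i hex.choose_spec.2 i hi (.refl_univ i)
    simp only [hv, dif_pos hex, this]
  obtain ⟨q, hq1, u, hu⟩ : ∃ q < 1, ∃ u, IsSupVec (powMatrix h θ) Cᶜ q u := by
    have hlt : blockRadius (powMatrix h θ) Cᶜ < 1 := by
      by_contra! hcon
      obtain ⟨H, hH, hH1, i, hi, hiC⟩ := exists_isSCComponent_of_one_le_blockRadius ha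
        (fun i j hij => (hP i j).2 ((hb.powMatrix_pos_iff hθ i j).1 hij)) h1.le hcon
      exact (Finset.mem_compl.1 hiC) ((hCmem i).2 ⟨H, ⟨hH, hH1⟩, hi⟩)
    obtain ⟨q, hq0, hq1, hq2⟩ := ENNReal.lt_iff_exists_real_btwn.1 hlt
    have hq : 0 < q := by
      by_contra! h
      rw [ENNReal.ofReal_of_nonpos h] at hq1
      exact absurd hq1 (by simp)
    exact ⟨q, ENNReal.ofReal_lt_one.1 hq2, exists_isSupVec ha hq hq1⟩
  refine hb.normCount_bounded hθ (C := C) (D := D) (v := v) ?_ ?_ ?_ ?_ ?_ ?_ hq1 hu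
  · exact Finset.disjoint_left.2 fun i hi hiD => ((hDmem i).1 hiD).1 hi
  · intro i hi j hij
    by_cases hj : j ∈ C
    · exact .inl hj
    · exact .inr ((hDmem j).2 ⟨hj, i, hi, .univ_of_pos ((hP i j).2 hij)⟩)
  · intro i hi j hij
    obtain ⟨hiC, k, hk, hki⟩ := (hDmem i).1 hi
    have hPij : PathIn P Finset.univ i j := .univ_of_pos ((hP i j).2 hij)
    refine (hDmem j).2 ⟨fun hj => hiC ?_, k, hk, hki.trans hPij⟩
    obtain ⟨H, hH, hkH⟩ := (hCmem k).1 hk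
    obtain ⟨H', hH', hjH'⟩ := (hCmem j).1 hj
    obtain rfl := huniq H hH H' hH' k hkH j hjH' (hki.trans hPij)
    exact (hCmem i).2 ⟨H, hH, hH.1.mem_of_pathIn hkH hjH' hki hPij⟩
  · intro i hi
    obtain ⟨H, hH, hiH⟩ := (hCmem i).1 hi
    rw [hvH H hH i hiH]
    exact (hF H hH).1 i hiH
  · intro i hi
    simp only [hv, dif_neg (mt (hCmem i).2 hi)]
  · intro i hi
    obtain ⟨H, hH, hiH⟩ := (hCmem i).1 hi
    rw [hvH H hH i hiH, ← (hF H hH).2 i hiH]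
    symm
    calc ∑ j ∈ H, powMatrix h θ i j * F H j = ∑ j ∈ H, powMatrix h θ i j * v j :=
          Finset.sum_congr rfl fun j hj => by rw [hvH H hH j hj]
      _ = ∑ j, powMatrix h θ i j * v j := by
        refine Finset.sum_subset (Finset.subset_univ _) fun j _ hj => ?_
        by_cases hij : 0 < h i j
        · have hjC : j ∉ C := fun hjC => by
            obtain ⟨H', hH', hjH'⟩ := (hCmem j).1 hjC
            obtain rfl := huniq H hH H' hH' i hiH j hjH' (.univ_of_pos ((hP i j).2 hij))
            exact hj hjH'
          simp only [hv, dif_neg (mt (hCmem j).2 hjC), mul_zero]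
        · rw [powMatrix_apply, ← (hb.nonneg i j).eq_of_not_lt hij, Real.zero_rpow hθ.ne', zero_mul]

theorem exists_exit {H : Finset (Fin N)} {i j : Fin N} (hi : i ∈ H) (hj : j ∉ H)
    (hij : PathIn P Finset.univ i j) :
    ∃ x ∈ H, ∃ y ∉ H, 0 < P x y ∧ PathIn P Finset.univ y j := by
  have hp := hij.2.2
  clear hij
  induction hp using Relation.ReflTransGen.head_induction_on with
  | refl => exact absurd hi hj
  | @head z z' hzz' hrest ih =>
    by_cases hz' : z' ∈ H
    · exact ih hz'
    · exact ⟨z, hi, z', hz', hzz'.2.2, Finset.mem_univ _, Finset.mem_univ _, hrest⟩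

/-- If the counts stayed below K at arbitrarily small levels, the iterates of a subvector of H₂
would increase to a fixed vector f. It is positive wherever H₂ is reachable, hence on H₁ and at the
end of an edge leaving H₁. That edge is a leak from a block of radius one, which rigidity forbids.
-/
theorem le_normCount_of_precedes (hb : HasBounds h η ρ) (hθ : 0 < θ)
    (hP : ∀ i j, 0 < P i j ↔ 0 < h i j) {H₁ H₂ : Finset (Fin N)}
    (hH₁ : H₁ ∈ unitComponents P h θ) (hH₂ : H₂ ∈ unitComponents P h θ) (hne : H₁ ≠ H₂)
    (hprec : Precedes P H₁ H₂) (K : ℝ) :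
    ∃ ε₀ > 0, ∀ n ε, ρ ^ n < ε → ε ≤ ε₀ → K ≤ ∑ i, normCount h θ n i ε := by
  by_contra! hcon
  have ha := hb.powMatrix_nonneg θ
  have hPa : ∀ i j, 0 < P i j → 0 < powMatrix h θ i j := fun i j hij =>
    (hb.powMatrix_pos_iff hθ i j).2 ((hP i j).1 hij)
  obtain ⟨w, hw, hw0⟩ := exists_isSubVec ha one_pos (by simpa using hH₂.2.ge)
  replace hw := hw.mono ha (Finset.subset_univ _) hw0
  obtain ⟨m, hm1, hm⟩ := exists_forall_le_mul w (fun _ => one_pos) 1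
  have hm0 : 0 < m := by linarith
  set A : (Fin N → ℝ) → Fin N → ℝ := fun f i => ∑ j, powMatrix h θ i j * f j with hA
  have hAmono : ∀ f g : Fin N → ℝ, (∀ i, f i ≤ g i) → ∀ i, A f i ≤ A g i := fun f g hfg i =>
    Finset.sum_le_sum fun j _ => mul_le_mul_of_nonneg_left (hfg j) (ha i j)
  -- Scaled to be at most 1, below the boundary values ε^θ at ε > 1.
  set v : Fin N → ℝ := fun i => m⁻¹ * w i with hv
  have hv0 : ∀ i, 0 ≤ v i := fun i => mul_nonneg (by positivity) (hw.1 i)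
  have hv1 : ∀ i, v i ≤ 1 := fun i => by
    simp only [hv]
    rw [inv_mul_le_iff₀ hm0]; simpa using hm i
  have hvA : ∀ i, v i ≤ A v i := fun i => by
    have h3 := hw.2.2 i (Finset.mem_univ _)
    calc m⁻¹ * w i ≤ m⁻¹ * ∑ j, powMatrix h θ i j * w j := by
          gcongr; linarith
      _ = _ := by rw [Finset.mul_sum]; exact Finset.sum_congr rfl fun j _ => by simp only [hv]; ring
  obtain ⟨k, hkH⟩ : ∃ k ∈ H₂, 0 < v k := by
    obtain ⟨k, _, hk⟩ := hw.2.1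
    refine ⟨k, ?_, by positivity⟩
    by_contra hk'
    rw [hw0 k hk'] at hk
    exact hk.false
  have hcount : ∀ l n i ε, ρ ^ n < ε → ε ≤ η ^ l → A^[l] v i ≤ normCount h θ n i ε := by
    intro l
    induction l with
    | zero => exact fun n i ε hε _ => hb.le_normCount hθ hv1 hvA n i ε hε
    | succ l ih =>
      intro n i ε hε hεη
      rw [Function.iterate_succ_apply']
      rw [pow_succ'] at hεη
      refine hb.sum_le_normCount hθ ?_ ih n i ε hε hεη
      rw [← pow_succ']
      exact pow_le_one₀ hb.pos.le hb.le_one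
  have hmono : ∀ i, Monotone fun l => A^[l] v i := by
    refine fun i => monotone_nat_of_le_succ fun l => ?_
    induction l generalizing i with
    | zero => exact hvA i
    | succ l ih =>
      rw [Function.iterate_succ_apply', Function.iterate_succ_apply']
      exact hAmono _ _ ih i
  have hbdd : ∀ i, BddAbove (Set.range fun l => A^[l] v i) := by
    refine fun i => ⟨K, ?_⟩
    rintro _ ⟨l, rfl⟩
    -- The l-th iterate is a lower bound only below level η^l; the negated claim supplies a level
    -- that small.
    obtain ⟨n, ε, hε, hεη, hlt⟩ := hcon (η ^ l) (pow_pos hb.pos l)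
    have hε0 : 0 < ε := (pow_pos hb.rho_pos _).trans hε
    exact ((hcount l n i ε hε hεη).trans (Finset.single_le_sum (f := fun i => normCount h θ n i ε)
      (fun j _ => normCount_nonneg h θ n j hε0) (Finset.mem_univ i))).trans hlt.le
  set f : Fin N → ℝ := fun i => ⨆ l, A^[l] v i with hf
  have hlim : ∀ i, Tendsto (fun l => A^[l] v i) atTop (𝓝 (f i)) := fun i =>
    tendsto_atTop_ciSup (hmono i) (hbdd i)
  have hfA : ∀ i, A f i = f i := by
    intro i
    refine tendsto_nhds_unique (f := fun l => A (A^[l] v) i) (l := atTop) ?_ ?_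
    · exact tendsto_finsetSum _ fun j _ => (hlim j).const_mul _
    · have := (hlim i).comp (tendsto_add_atTop_nat 1)
      refine this.congr fun l => ?_
      simp only [Function.comp_apply, Function.iterate_succ_apply']
  have hvf : ∀ i, v i ≤ f i := fun i => le_ciSup (hbdd i) 0
  have hf0 : ∀ i, 0 ≤ f i := fun i => (hv0 i).trans (hvf i)
  have hfpos : ∀ x, PathIn P Finset.univ x k → 0 < f x := by
    intro x hx
    have hp := hx.2.2
    clear hx
    induction hp using Relation.ReflTransGen.head_induction_on with
    | refl => exact hkH.2.trans_le (hvf k)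
    | @head z z' hzz' _ ih =>
      rw [← hfA]
      exact Finset.sum_pos' (fun j _ => mul_nonneg (ha z j) (hf0 j))
        ⟨z', Finset.mem_univ _, mul_pos (hPa z z' hzz'.2.2) ih⟩
  obtain ⟨i, hi, j, hj, hij⟩ := hprec
  have hjk : PathIn P Finset.univ j k :=
    (hH₂.1.1.2 j hj k hkH.1).mono (Finset.subset_univ _)
  have hj₁ : j ∉ H₁ := fun hj₁ => hne (hH₁.1.eq_of_mem hH₂.1 hj₁ hj)
  obtain ⟨x, hx, y, hy, hxy, hyj⟩ := exists_exit hi hj₁ hij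
  obtain ⟨w₁, hw₁, -⟩ := exists_isSubVec ha one_pos (by simpa using hH₁.2.ge)
  -- The defect e is the part of a f coming from outside H₁.
  have hzero := (hH₁.1.1.eq_of_isSubVec ha hPa
    (fun z hz => hfpos z (((hH₁.1.1.2 z hz i hi).mono (Finset.subset_univ _)).trans
      (hij.trans hjk))) hw₁ (e := fun z => ∑ l ∈ H₁ᶜ, powMatrix h θ z l * f l)
    (fun z _ => Finset.sum_nonneg fun l _ => mul_nonneg (ha z l) (hf0 l))
    (fun z _ => by rw [Finset.sum_add_sum_compl]; exact (hfA z).le) x hx).1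
  have hpos : 0 < ∑ l ∈ H₁ᶜ, powMatrix h θ x l * f l :=
    Finset.sum_pos' (fun l _ => mul_nonneg (ha x l) (hf0 l))
      ⟨y, by simpa using hy, mul_pos (hPa x y hxy) (hfpos y (hyj.trans hjk))⟩
  exact hpos.ne' hzero

theorem le_normCount_of_not_pairwise (hb : HasBounds h η ρ) (hθ : 0 < θ)
    (hP : ∀ i j, 0 < P i j ↔ 0 < h i j)
    (hpw : ¬ (unitComponents P h θ).Pairwise (Incomparable P)) (K : ℝ) :
    ∃ ε₀ > 0, ∀ n ε, ρ ^ n < ε → ε ≤ ε₀ → K ≤ ∑ i, normCount h θ n i ε := by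
  simp only [Set.Pairwise, not_forall, Incomparable, not_and_or, not_not] at hpw
  obtain ⟨H₁, hH₁, H₂, hH₂, hne, hprec | hprec⟩ := hpw
  · exact le_normCount_of_precedes hb hθ hP hH₁ hH₂ hne hprec K
  · exact le_normCount_of_precedes hb hθ hP hH₂ hH₁ hne.symm hprec K

end CriticalComponents

end MarkovQuantization

namespace MarkovQuantization

/-! ### Cylinder probabilities of the Markov chain. -/

section MarkovMeasure

variable {N : ℕ} {P : Matrix (Fin N) (Fin N) ℝ} {χ : Fin N → ℝ}

theorem vecMeasure_apply (v : Fin N → ℝ) (s : Set (Fin N)) [DecidablePred (· ∈ s)] :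
    vecMeasure v s = ∑ i, if i ∈ s then ENNReal.ofReal (v i) else 0 := by
  simp [vecMeasure, Measure.coe_finsetSum, Finset.sum_apply, Set.indicator_apply]

theorem vecMeasure_singleton (v : Fin N → ℝ) (i : Fin N) :
    vecMeasure v {i} = ENNReal.ofReal (v i) := by
  rw [vecMeasure_apply, Finset.sum_eq_single i] <;> simp +contextual

theorem stepKernel_apply (n : ℕ) (y : (i : Finset.Iic n) → Fin N) :
    stepKernel P n y = vecMeasure (P (y ⟨n, Finset.mem_Iic.2 le_rfl⟩)) := rfl

variable (hP : ∀ i, P i ∈ stdSimplex ℝ (Fin N)) (hχ : χ ∈ stdSimplex ℝ (Fin N))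

theorem isProbabilityMeasure_markovMeasure : IsProbabilityMeasure (markovMeasure P χ hP hχ) := by
  have := isProbabilityMeasure_vecMeasure hχ
  have := isMarkovKernel_stepKernel hP
  rw [markovMeasure]
  infer_instance

theorem map_markovMeasure_compProd (n : ℕ) :
    (markovMeasure P χ hP hχ).map (Preorder.frestrictLe n) ⊗ₘ stepKernel P n =
      (markovMeasure P χ hP hχ).map (fun x => (Preorder.frestrictLe n x, x (n + 1))) := by
  have := isProbabilityMeasure_vecMeasure hχ
  have := isMarkovKernel_stepKernel hP
  exact Kernel.map_frestrictLe_trajMeasure_compProd_eq_map_trajMeasure (X := fun _ => Fin N)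

theorem map_frestrictLe_zero_markovMeasure :
    (markovMeasure P χ hP hχ).map (Preorder.frestrictLe 0) =
      (vecMeasure χ).map (MeasurableEquiv.piUnique fun _ : Finset.Iic 0 => Fin N).symm := by
  have := isProbabilityMeasure_vecMeasure hχ
  have := isMarkovKernel_stepKernel hP
  rw [markovMeasure, Kernel.trajMeasure, Measure.map_comp _ _ (by fun_prop),
    Kernel.traj_map_frestrictLe, Kernel.partialTraj_self]
  exact Measure.id_comp

theorem markovMeasure_cylinder (x : ℕ → Fin N) (k : ℕ) :
    markovMeasure P χ hP hχ {ω | ∀ m ≤ k, ω m = x m} =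
      ENNReal.ofReal (χ (x 0) * ∏ m ∈ Finset.range k, P (x m) (x (m + 1))) := by
  have := isProbabilityMeasure_markovMeasure hP hχ
  have := isMarkovKernel_stepKernel hP
  have hset : ∀ k, {ω : ℕ → Fin N | ∀ m ≤ k, ω m = x m} =
      Preorder.frestrictLe (π := fun _ => Fin N) k ⁻¹' {Preorder.frestrictLe k x} := by
    intro k
    ext ω
    simp [funext_iff]
  induction k with
  | zero =>
    rw [hset, ← Measure.map_apply (by fun_prop) (measurableSet_singleton _),
      map_frestrictLe_zero_markovMeasure,
      Measure.map_apply (by fun_prop) (measurableSet_singleton _)]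
    have : (MeasurableEquiv.piUnique fun _ : Finset.Iic 0 => Fin N).symm ⁻¹'
        {Preorder.frestrictLe (π := fun _ => Fin N) 0 x} = {x 0} := by
      ext z
      rw [Set.mem_preimage, Set.mem_singleton_iff, MeasurableEquiv.symm_apply_eq]
      rfl
    rw [this, vecMeasure_singleton]
    simp
  | succ k ih =>
    have hset' : {ω : ℕ → Fin N | ∀ m ≤ k + 1, ω m = x m} =
        (fun ω : ℕ → Fin N => (Preorder.frestrictLe (π := fun _ => Fin N) k ω, ω (k + 1))) ⁻¹'
          ({Preorder.frestrictLe k x} ×ˢ {x (k + 1)}) := by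
      ext ω
      have hω : (∀ m ≤ k, ω m = x m) ↔
          Preorder.frestrictLe (π := fun _ => Fin N) k ω = Preorder.frestrictLe k x :=
        Set.ext_iff.1 (hset k) ω
      simp only [Set.mem_preimage, Set.mem_prod, Set.mem_singleton_iff, ← hω, Set.mem_ofPred_eq]
      exact ⟨fun h => ⟨fun m hm => h m (by omega), h _ le_rfl⟩, fun h m hm => by
        rcases Nat.lt_or_ge m (k + 1) with h1 | h1
        · exact h.1 m (by omega)
        · obtain rfl : m = k + 1 := by omega
          exact h.2⟩
    rw [hset', ← Measure.map_apply (by fun_prop)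
      ((measurableSet_singleton _).prod (measurableSet_singleton _)),
      ← map_markovMeasure_compProd, Measure.compProd_apply_prod (measurableSet_singleton _)
      (measurableSet_singleton _), lintegral_singleton, stepKernel_apply, vecMeasure_singleton,
      Measure.map_apply (by fun_prop) (measurableSet_singleton _), ← hset, ih, mul_comm,
      ← ENNReal.ofReal_mul (mul_nonneg (hχ.1 _) (Finset.prod_nonneg fun m _ => (hP _).1 _)),
      Finset.prod_range_succ, mul_assoc]
    rfl

theorem measurableSet_infWords : MeasurableSet (infWords P) := by
  rw [infWords, Set.ofPred_forall]
  refine MeasurableSet.iInter fun k => ?_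
  have hm : Measurable fun ω : ℕ → Fin N => (ω k, ω (k + 1)) := by fun_prop
  exact hm (t := {p : Fin N × Fin N | 0 < P p.1 p.2}) (MeasurableSet.of_discrete)

theorem ae_mem_infWords : ∀ᵐ ω ∂markovMeasure P χ hP hχ, ω ∈ infWords P := by
  have := isProbabilityMeasure_markovMeasure hP hχ
  have := isMarkovKernel_stepKernel hP
  refine ae_all_iff.2 fun k => ?_
  have hm : MeasurableSet {p : ((i : Finset.Iic k) → Fin N) × Fin N |
      0 < P (p.1 ⟨k, Finset.mem_Iic.2 le_rfl⟩) p.2} := .of_discrete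
  have h1 : ∀ᵐ p ∂((markovMeasure P χ hP hχ).map (Preorder.frestrictLe k) ⊗ₘ stepKernel P k),
      0 < P (p.1 ⟨k, Finset.mem_Iic.2 le_rfl⟩) p.2 := by
    refine Measure.ae_compProd_of_ae_ae hm (Eventually.of_forall fun y => ?_)
    classical
    rw [ae_iff, stepKernel_apply, vecMeasure_apply]
    refine Finset.sum_eq_zero fun i _ => ?_
    split_ifs with hi
    · exact ENNReal.ofReal_of_nonpos (not_lt.1 hi)
    · rfl
  rw [map_markovMeasure_compProd, ae_map_iff (by fun_prop) hm] at h1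
  exact h1

end MarkovMeasure

/-! ### Words, weights along words, and sequence cylinders. -/

section Words

variable {N : ℕ} {P : Matrix (Fin N) (Fin N) ℝ}

/-- The product of the entries of `f` along a word. -/
def wordWeight (f : Matrix (Fin N) (Fin N) ℝ) : List (Fin N) → ℝ
  | [] => 1
  | [_] => 1
  | i :: j :: l => f i j * wordWeight f (j :: l)

theorem wordWeight_append_pair (f : Matrix (Fin N) (Fin N) ℝ) (σ : List (Fin N)) (a i : Fin N) :
    wordWeight f (σ ++ [a, i]) = wordWeight f (σ ++ [a]) * f a i := by
  induction σ with
  | nil => simp [wordWeight]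
  | cons b τ ih =>
    cases τ with
    | nil => simp [wordWeight]
    | cons b' τ' =>
      simp only [List.cons_append, wordWeight] at ih ⊢
      rw [ih, mul_assoc]

theorem initWord_succ (ω : ℕ → Fin N) (k : ℕ) :
    initWord ω (k + 1) = initWord ω k ++ [ω k] := by
  simp [initWord, List.range_succ]

theorem initWord_succ_succ (ω : ℕ → Fin N) (k : ℕ) :
    initWord ω (k + 2) = initWord ω k ++ [ω k, ω (k + 1)] := by
  simp [initWord, List.range_succ]

theorem length_initWord (ω : ℕ → Fin N) (k : ℕ) : (initWord ω k).length = k := by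
  simp [initWord]

theorem initWord_succ' (ω : ℕ → Fin N) (k : ℕ) :
    initWord ω (k + 1) = ω 0 :: initWord (fun m => ω (m + 1)) k := by
  simp [initWord, List.range_succ_eq_map, Function.comp_def]

theorem wordWeight_initWord (f : Matrix (Fin N) (Fin N) ℝ) (ω : ℕ → Fin N) (k : ℕ) :
    wordWeight f (initWord ω (k + 1)) = ∏ m ∈ Finset.range k, f (ω m) (ω (m + 1)) := by
  induction k with
  | zero => simp [initWord, wordWeight]
  | succ k ih =>
    rw [initWord_succ_succ, wordWeight_append_pair, ← initWord_succ, ih, Finset.prod_range_succ]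

theorem initWord_eq_iff (ω x : ℕ → Fin N) (k : ℕ) :
    initWord ω (k + 1) = initWord x (k + 1) ↔ ∀ m ≤ k, ω m = x m := by
  simp only [initWord, List.map_inj_left, List.mem_range, Nat.lt_succ_iff]

theorem exists_eq_initWord {σ : List (Fin N)} (hσ : σ ≠ []) :
    ∃ (x : ℕ → Fin N) (k : ℕ), σ = initWord x (k + 1) := by
  obtain ⟨i, τ, rfl⟩ := List.exists_cons_of_ne_nil hσ
  -- The letter used to pad the word beyond its end is immaterial.
  refine ⟨fun m => (i :: τ).getD m i, τ.length, ?_⟩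
  refine List.ext_getElem (by simp [initWord]) fun m h1 h2 => ?_
  simp only [initWord, List.getElem_map, List.getElem_range]
  rw [List.getD_eq_getElem _ _ h1]

theorem isWord_initWord {ω : ℕ → Fin N} (hω : ω ∈ infWords P) (k : ℕ) :
    IsWord P (initWord ω k) := by
  rw [IsWord, List.isChain_iff_getElem]
  intro i hi
  simp only [initWord, List.getElem_map, List.getElem_range]
  exact hω i

theorem wordWeight_pos {f : Matrix (Fin N) (Fin N) ℝ} (hf : ∀ i j, 0 < P i j → 0 < f i j) :
    ∀ {σ : List (Fin N)}, IsWord P σ → 0 < wordWeight f σ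
  | [], _ => one_pos
  | [_], _ => one_pos
  | i :: j :: l, h => by
    rw [IsWord, List.isChain_cons_cons] at h
    exact mul_pos (hf i j h.1) (wordWeight_pos hf h.2)

/-- The set of sequences starting with the word `σ`. -/
def wordCylinder (σ : List (Fin N)) : Set (ℕ → Fin N) := {ω | initWord ω σ.length = σ}

theorem wordCylinder_initWord (x : ℕ → Fin N) (k : ℕ) :
    wordCylinder (initWord x (k + 1)) = {ω | ∀ m ≤ k, ω m = x m} := by
  ext ω
  rw [wordCylinder, Set.mem_ofPred_eq, length_initWord, initWord_eq_iff]
  rfl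

theorem measurableSet_wordCylinder {σ : List (Fin N)} (hσ : σ ≠ []) :
    MeasurableSet (wordCylinder σ) := by
  obtain ⟨x, k, rfl⟩ := exists_eq_initWord hσ
  rw [wordCylinder_initWord]
  measurability

theorem markovMeasure_wordCylinder {χ : Fin N → ℝ} (hP : ∀ i, P i ∈ stdSimplex ℝ (Fin N))
    (hχ : χ ∈ stdSimplex ℝ (Fin N)) (i : Fin N) (τ : List (Fin N)) :
    markovMeasure P χ hP hχ (wordCylinder (i :: τ)) =
      ENNReal.ofReal (χ i * wordWeight P (i :: τ)) := by
  obtain ⟨x, k, hx⟩ := exists_eq_initWord (List.cons_ne_nil i τ)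
  have hi : i = x 0 := by
    rw [initWord_succ'] at hx
    exact (List.cons.inj hx).1
  rw [hx, wordCylinder_initWord, markovMeasure_cylinder, wordWeight_initWord, hi]

end Words

/-! ### Cylinder sets and the coding map. -/

section Cylinders

variable {N : ℕ} {E : Type*} [NormedAddCommGroup E] {P c : Matrix (Fin N) (Fin N) ℝ} {J : List (Fin N) → Set E}

theorem eq_singleton_or_append_pair {α : Type*} {σ : List α} (hσ : σ ≠ []) :
    (∃ i, σ = [i]) ∨ ∃ τ a i, σ = τ ++ [a, i] := by
  obtain ⟨τ, i, rfl⟩ := σ.eq_nil_or_concat'.resolve_left hσ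
  rcases τ.eq_nil_or_concat' with rfl | ⟨τ', a, rfl⟩
  · exact .inl ⟨i, rfl⟩
  · exact .inr ⟨τ', a, i, by simp⟩

theorem IsCylinderSystem.nonempty_word (hJ : IsCylinderSystem P c J) {σ : List (Fin N)}
    (hσ : IsWord P σ) (h0 : σ ≠ []) : (J σ).Nonempty := by
  rcases eq_singleton_or_append_pair h0 with ⟨i, rfl⟩ | ⟨τ, a, i, rfl⟩
  · exact hJ.nonempty i
  · obtain ⟨j, f, hf⟩ := hJ.similar τ a i hσ
    rw [hf]
    exact (hJ.nonempty j).image _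

theorem IsCylinderSystem.isCompact_word (hJ : IsCylinderSystem P c J) {σ : List (Fin N)}
    (hσ : IsWord P σ) (h0 : σ ≠ []) : IsCompact (J σ) := by
  rcases eq_singleton_or_append_pair h0 with ⟨i, rfl⟩ | ⟨τ, a, i, rfl⟩
  · exact hJ.isCompact i
  · obtain ⟨j, f, hf⟩ := hJ.similar τ a i hσ
    rw [hf]
    exact (hJ.isCompact j).image f.toHomeomorph.continuous

theorem IsCylinderSystem.diam_word (hJ : IsCylinderSystem P c J) {σ : List (Fin N)}
    (hσ : IsWord P σ) (h0 : σ ≠ []) : Metric.diam (J σ) = wordWeight c σ := by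
  obtain ⟨x, k, rfl⟩ := exists_eq_initWord h0
  clear h0
  induction k with
  | zero => simpa [initWord, wordWeight] using hJ.diam_one (x 0)
  | succ k ih =>
    rw [initWord_succ_succ] at hσ ⊢
    rw [hJ.diam_ratio _ _ _ hσ, wordWeight_append_pair, ← initWord_succ, ih, mul_comm]
    refine List.IsChain.prefix hσ ?_
    rw [initWord_succ]
    exact ⟨[x (k + 1)], by simp⟩

theorem IsCylinderSystem.subset_of_prefix (hJ : IsCylinderSystem P c J) {σ τ : List (Fin N)}
    (hσ : IsWord P σ) (h0 : τ ≠ []) (hτ : τ <+: σ) : J σ ⊆ J τ := by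
  obtain ⟨l, rfl⟩ := hτ
  induction l using List.reverseRecOn with
  | nil => simp
  | append_singleton l i ih =>
    obtain ⟨τ', a, ha⟩ := (τ ++ l).eq_nil_or_concat'.resolve_left (by simp [h0])
    rw [← List.append_assoc, ha, List.append_assoc] at hσ ⊢
    have h1 := hJ.subset τ' a i hσ
    rw [← ha] at h1
    refine h1.trans (ih ?_)
    rw [ha]
    exact List.IsChain.prefix hσ ⟨[i], by simp⟩

theorem initWord_prefix (ω : ℕ → Fin N) (k : ℕ) : initWord ω k <+: initWord ω (k + 1) := by
  rw [initWord_succ]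
  exact List.prefix_append _ _

theorem initWord_ne_nil (ω : ℕ → Fin N) (k : ℕ) : initWord ω (k + 1) ≠ [] := by
  rw [initWord_succ]; simp

theorem IsCylinderSystem.proj_mem (hJ : IsCylinderSystem P c J) {ω : ℕ → Fin N}
    (hω : ω ∈ infWords P) (k : ℕ) : proj P J ω ∈ J (initWord ω (k + 1)) := by
  have hne : (⋂ k : ℕ, J (initWord ω (k + 1))).Nonempty := by
    refine IsCompact.nonempty_iInter_of_sequence_nonempty_isCompact_isClosed _ (fun k => ?_)
      (fun k => hJ.nonempty_word (isWord_initWord hω _) (initWord_ne_nil ω k))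
      (hJ.isCompact_word (isWord_initWord hω _) (initWord_ne_nil ω 0))
      (fun k => (hJ.isCompact_word (isWord_initWord hω _) (initWord_ne_nil ω k)).isClosed)
    exact hJ.subset_of_prefix (isWord_initWord hω _) (initWord_ne_nil ω k) (initWord_prefix ω _)
  have h : ω ∈ infWords P ∧ (⋂ k : ℕ, J (initWord ω (k + 1))).Nonempty := ⟨hω, hne⟩
  rw [proj, dif_pos h]
  exact Set.mem_iInter.1 h.2.some_mem k

theorem IsCylinderSystem.proj_mem_of_mem_wordCylinder (hJ : IsCylinderSystem P c J)
    {ω : ℕ → Fin N} (hω : ω ∈ infWords P) {σ : List (Fin N)} (hσ : σ ≠ [])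
    (h : ω ∈ wordCylinder σ) : proj P J ω ∈ J σ := by
  obtain ⟨i, τ, rfl⟩ := List.exists_cons_of_ne_nil hσ
  have h1 := hJ.proj_mem hω τ.length
  rwa [show initWord ω (τ.length + 1) = i :: τ from h] at h1

-- The map is a pointwise limit of maps depending on finitely many letters, since the diameters
-- shrink at least geometrically. Without measurability `Measure.map` could take its default value
-- 0.
open Classical in
theorem IsCylinderSystem.measurable_proj [MeasurableSpace E] [BorelSpace E]
    (hJ : IsCylinderSystem P c J) (hc0 : ∀ i j, 0 ≤ c i j) (hc1 : ∀ i j, c i j < 1) :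
    Measurable (proj P J) := by
  obtain ⟨η, ρ, hb⟩ := exists_hasBounds hc0 hc1
  set pick : List (Fin N) → E := fun σ => if h : (J σ).Nonempty then h.some else 0 with hpick
  set f : ℕ → (ℕ → Fin N) → E := fun k =>
    (infWords P).indicator fun ω => pick (initWord ω (k + 1)) with hf
  refine measurable_of_tendsto_metrizable (f := f) (fun k => ?_) (tendsto_pi_nhds.2 fun ω => ?_)
  · refine Measurable.indicator ?_ measurableSet_infWords
    have h1 : (fun ω : ℕ → Fin N => pick (initWord ω (k + 1))) =
        (fun y : Fin (k + 1) → Fin N => pick (List.ofFn y)) ∘ fun ω m => ω m := by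
      ext ω
      simp only [Function.comp_apply]
      congr 1
      exact List.ext_getElem (by simp [initWord]) fun m _ _ => by
        simp only [initWord, List.getElem_map, List.getElem_range, List.getElem_ofFn]
    rw [h1]
    exact Measurable.of_discrete.comp (by fun_prop)
  · by_cases hω : ω ∈ infWords P
    · rw [tendsto_iff_dist_tendsto_zero]
      refine squeeze_zero (g := fun k => ρ ^ k) (fun _ => dist_nonneg) (fun k => ?_)
        (tendsto_pow_atTop_nhds_zero_of_lt_one hb.rho_pos.le hb.rho_lt_one)
      have hw := isWord_initWord hω (k + 1)
      have h0 := initWord_ne_nil ω k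
      have hne := hJ.nonempty_word hw h0
      have h2 : f k ω ∈ J (initWord ω (k + 1)) := by
        simp only [hf, hpick, Set.indicator_of_mem hω, dif_pos hne]
        exact hne.some_mem
      refine (Metric.dist_le_diam_of_mem (hJ.isCompact_word hw h0).isBounded h2
        (hJ.proj_mem hω k)).trans ?_
      rw [hJ.diam_word hw h0, wordWeight_initWord]
      refine (Finset.prod_le_prod (fun _ _ => hc0 _ _) fun _ _ => hb.le_rho _ _).trans ?_
      simp
    · have h1 : proj P J ω = 0 := by rw [proj, dif_neg fun h => hω h.1]
      simp only [hf, Set.indicator_of_notMem hω, h1]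
      exact tendsto_const_nhds

end Cylinders

end MarkovQuantization

/-- Quantization uses `nrm`, whereas diameters and separation use the norm of the space; compactness
of the unit sphere makes them comparable. -/
theorem Seminorm.exists_equiv_norm {E : Type*} [NormedAddCommGroup E] [NormedSpace ℝ E]
    [FiniteDimensional ℝ E] (nrm : Seminorm ℝ E) (hnrm : ∀ x, nrm x = 0 → x = 0) :
    Continuous nrm ∧ ∃ K₁ > 0, ∃ K₂ > 0, ∀ x, K₁ * ‖x‖ ≤ nrm x ∧ nrm x ≤ K₂ * ‖x‖ := by
  have hcont : Continuous nrm := by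
    have := nrm.convexOn.locallyLipschitz
    exact this.continuous
  obtain ⟨K₂, hK₂, hle⟩ := Seminorm.bound_of_continuous_normedSpace nrm hcont
  have : ProperSpace E := FiniteDimensional.proper ℝ E
  obtain ⟨K₁, hK₁, hK⟩ : ∃ K₁ > 0, ∀ x ∈ Metric.sphere (0 : E) 1, K₁ ≤ nrm x := by
    rcases (Metric.sphere (0 : E) 1).eq_empty_or_nonempty with h | h
    · exact ⟨1, one_pos, by simp [h]⟩
    · obtain ⟨x, hx, hmin⟩ := (isCompact_sphere (0 : E) 1).exists_isMinOn h hcont.continuousOn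
      refine ⟨nrm x, (apply_nonneg nrm x).lt_of_ne' fun h0 => ?_, fun y hy => hmin hy⟩
      rw [hnrm x h0] at hx
      simp at hx
  refine ⟨hcont, K₁, hK₁, K₂, hK₂, fun x => ⟨?_, hle x⟩⟩
  rcases eq_or_ne x 0 with rfl | hx
  · simp
  · have hx' : 0 < ‖x‖ := norm_pos_iff.2 hx
    have h1 := hK (‖x‖⁻¹ • x) (by simp [norm_smul, hx'.ne'])
    rw [map_smul_eq_mul, norm_inv, norm_norm, le_inv_mul_iff₀ hx'] at h1
    linarith

namespace MarkovQuantization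

/-! ### Cut words as a partition with comparable weights. -/

section CutWordsGeometry

variable {N : ℕ} {P h : Matrix (Fin N) (Fin N) ℝ} {η ρ : ℝ}

theorem isWord_of_mem_cutWords (hP : ∀ i j, 0 < P i j ↔ 0 < h i j) {n : ℕ} {i : Fin N} {ε : ℝ}
    {σ : List (Fin N)} (hσ : σ ∈ cutWords h n i ε) : IsWord P σ := by
  have hone : ∀ n i ε σ, (1 : ℝ) < ε → σ ∈ cutWords h n i ε → IsWord P σ := by
    intro n i ε σ hε hσ
    rw [cutWords_of_one_lt h n i hε, Finset.mem_singleton] at hσ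
    simp [hσ, IsWord]
  induction n generalizing i ε σ with
  | zero => simp_all [cutWords, IsWord]
  | succ n ih =>
    rcases lt_or_ge 1 ε with hε | hε
    · exact hone _ i ε σ hε hσ
    · obtain ⟨j, hij, τ, hτ, rfl⟩ := (mem_cutWords_succ hε).1 hσ
      obtain ⟨τ', rfl⟩ := exists_eq_cons_of_mem_cutWords hτ
      rw [IsWord, List.isChain_cons_cons]
      exact ⟨(hP i j).2 hij, ih hτ⟩

theorem wordWeight_lt_of_mem_cutWords (hb : HasBounds h η ρ) {n : ℕ} {i : Fin N} {ε : ℝ}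
    (hε : ρ ^ n < ε) {σ : List (Fin N)} (hσ : σ ∈ cutWords h n i ε) : wordWeight h σ < ε := by
  have hone : ∀ n i ε σ, (1 : ℝ) < ε → σ ∈ cutWords h n i ε → wordWeight h σ < ε := by
    intro n i ε σ hε hσ
    rw [cutWords_of_one_lt h n i hε, Finset.mem_singleton] at hσ
    simpa [hσ, wordWeight] using hε
  induction n generalizing i ε σ with
  | zero => exact hone 0 i ε σ (by simpa using hε) hσ
  | succ n ih =>
    rcases lt_or_ge 1 ε with h1 | h1
    · exact hone _ i ε σ h1 hσ
    · obtain ⟨j, hij, τ, hτ, rfl⟩ := (mem_cutWords_succ h1).1 hσ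
      have h2 := ih (hb.pow_lt_div hε hij) hτ
      obtain ⟨τ', rfl⟩ := exists_eq_cons_of_mem_cutWords hτ
      rw [lt_div_iff₀ hij] at h2
      rwa [wordWeight, mul_comm]

theorem le_wordWeight_of_mem_cutWords (hb : HasBounds h η ρ) {n : ℕ} {i : Fin N} {ε : ℝ}
    (hε0 : 0 < ε) (hε : ε ≤ η⁻¹) {σ : List (Fin N)} (hσ : σ ∈ cutWords h n i ε) :
    η * ε ≤ wordWeight h σ := by
  have hone : ∀ ε, ε ≤ η⁻¹ → ∀ i, η * ε ≤ wordWeight h [i] := fun ε hε i => by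
    rw [wordWeight]
    calc η * ε ≤ η * η⁻¹ := mul_le_mul_of_nonneg_left hε hb.pos.le
      _ = 1 := mul_inv_cancel₀ hb.pos.ne'
  induction n generalizing i ε σ with
  | zero =>
    rw [cutWords, Finset.mem_singleton] at hσ
    exact hσ ▸ hone ε hε i
  | succ n ih =>
    rcases lt_or_ge 1 ε with h1 | h1
    · rw [cutWords_of_one_lt h _ i h1, Finset.mem_singleton] at hσ
      exact hσ ▸ hone ε hε i
    · obtain ⟨j, hij, τ, hτ, rfl⟩ := (mem_cutWords_succ h1).1 hσ
      have h2 := ih (div_pos hε0 hij)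
        (hb.div_le hε0 (by rwa [mul_inv_cancel₀ hb.pos.ne']) hij) hτ
      obtain ⟨τ', rfl⟩ := exists_eq_cons_of_mem_cutWords hτ
      rw [mul_div_assoc', div_le_iff₀ hij] at h2
      rwa [wordWeight, mul_comm (h i j)]

/-- Two distinct cut words part at a common prefix, so neither extends the other. This is the form
in which the separation condition and the disjointness of cylinders apply. -/
theorem exists_branch_of_mem_cutWords {n : ℕ} {i : Fin N} {ε : ℝ} {σ τ : List (Fin N)}
    (hσ : σ ∈ cutWords h n i ε) (hτ : τ ∈ cutWords h n i ε) (hne : σ ≠ τ) :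
    ∃ κ a b, a ≠ b ∧ κ ++ [a] <+: σ ∧ κ ++ [b] <+: τ := by
  induction n generalizing i ε σ τ with
  | zero => simp_all [cutWords]
  | succ n ih =>
    rcases lt_or_ge 1 ε with h1 | h1
    · rw [cutWords_of_one_lt h _ i h1, Finset.mem_singleton] at hσ hτ
      exact absurd (hσ.trans hτ.symm) hne
    · obtain ⟨j, hij, σ', hσ', rfl⟩ := (mem_cutWords_succ h1).1 hσ
      obtain ⟨k, hik, τ', hτ', rfl⟩ := (mem_cutWords_succ h1).1 hτ
      rcases eq_or_ne j k with rfl | hjk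
      · obtain ⟨κ, a, b, hab, ha, hb⟩ := ih hσ' hτ' (fun h => hne (by rw [h]))
        exact ⟨i :: κ, a, b, hab, by simpa using ha, by simpa using hb⟩
      · obtain ⟨σ'', rfl⟩ := exists_eq_cons_of_mem_cutWords hσ'
        obtain ⟨τ'', rfl⟩ := exists_eq_cons_of_mem_cutWords hτ'
        exact ⟨[i], j, k, hjk, by simp, by simp⟩

theorem exists_mem_cutWords_of_mem_infWords (hP : ∀ i j, 0 < P i j ↔ 0 < h i j) (n : ℕ) (ε : ℝ)
    {ω : ℕ → Fin N} (hω : ω ∈ infWords P) :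
    ∃ σ ∈ cutWords h n (ω 0) ε, ω ∈ wordCylinder σ := by
  have hone : ∀ ω : ℕ → Fin N, ω ∈ wordCylinder [ω 0] := fun ω => by
    simp [wordCylinder, initWord]
  induction n generalizing ω ε with
  | zero => exact ⟨[ω 0], by simp [cutWords], hone ω⟩
  | succ n ih =>
    rcases lt_or_ge 1 ε with h1 | h1
    · exact ⟨[ω 0], by simp [cutWords_of_one_lt h _ _ h1], hone ω⟩
    · obtain ⟨τ, hτ, hωτ⟩ := ih (ε / h (ω 0) (ω 1)) (ω := fun m => ω (m + 1)) fun m => hω (m + 1)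
      refine ⟨ω 0 :: τ, (mem_cutWords_succ h1).2
        ⟨ω 1, (hP _ _).1 (hω 0), τ, hτ, rfl⟩, ?_⟩
      rw [wordCylinder, Set.mem_ofPred_eq, List.length_cons, initWord_succ']
      rw [wordCylinder, Set.mem_ofPred_eq] at hωτ
      rw [hωτ]

/-- All words cut at the level `ε`. -/
noncomputable def allCutWords (h : Matrix (Fin N) (Fin N) ℝ) (n : ℕ) (ε : ℝ) :
    Finset (List (Fin N)) :=
  Finset.univ.biUnion fun i => cutWords h n i ε

theorem mem_allCutWords {n : ℕ} {ε : ℝ} {σ : List (Fin N)} :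
    σ ∈ allCutWords h n ε ↔ ∃ i, σ ∈ cutWords h n i ε := by
  simp [allCutWords]

theorem card_allCutWords (n : ℕ) (ε : ℝ) :
    (allCutWords h n ε).card = ∑ i, (cutWords h n i ε).card := by
  refine Finset.card_biUnion fun i _ j _ hij => Finset.disjoint_left.2 fun σ hσ hσ' => hij ?_
  obtain ⟨τ, rfl⟩ := exists_eq_cons_of_mem_cutWords hσ
  obtain ⟨τ', h2⟩ := exists_eq_cons_of_mem_cutWords hσ'
  exact (List.cons.inj h2).1

theorem exists_branch_of_mem_allCutWords {n : ℕ} {ε : ℝ} {σ τ : List (Fin N)}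
    (hσ : σ ∈ allCutWords h n ε) (hτ : τ ∈ allCutWords h n ε) (hne : σ ≠ τ) :
    ∃ κ a b, a ≠ b ∧ κ ++ [a] <+: σ ∧ κ ++ [b] <+: τ := by
  obtain ⟨i, hi⟩ := mem_allCutWords.1 hσ
  obtain ⟨j, hj⟩ := mem_allCutWords.1 hτ
  rcases eq_or_ne i j with rfl | hij
  · exact exists_branch_of_mem_cutWords hi hj hne
  · obtain ⟨σ', rfl⟩ := exists_eq_cons_of_mem_cutWords hi
    obtain ⟨τ', rfl⟩ := exists_eq_cons_of_mem_cutWords hj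
    exact ⟨[], i, j, hij, by simp, by simp⟩

theorem pairwiseDisjoint_wordCylinder (n : ℕ) (ε : ℝ) :
    (allCutWords h n ε : Set (List (Fin N))).PairwiseDisjoint wordCylinder := by
  intro σ hσ τ hτ hne
  obtain ⟨κ, a, b, hab, ha, hb⟩ := exists_branch_of_mem_allCutWords hσ hτ hne
  refine Set.disjoint_left.2 fun ω hω hω' => hab ?_
  rw [wordCylinder, Set.mem_ofPred_eq] at hω hω'
  have key : ∀ l x, κ ++ [x] <+: initWord ω l → x = ω κ.length := by
    intro l x hx
    have h1 := hx.getElem (i := κ.length) (by simp)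
    simpa [initWord] using h1
  rw [← hω] at ha
  rw [← hω'] at hb
  rw [key _ a ha, key _ b hb]

end CutWordsGeometry

/-! ### Quantization error against the number of cut words. -/

section QuantizationError

variable {N : ℕ} {E : Type*} [NormedAddCommGroup E] [NormedSpace ℝ E]
  [MeasurableSpace E] {P c : Matrix (Fin N) (Fin N) ℝ} {χ : Fin N → ℝ}
  {J : List (Fin N) → Set E} {r η ρ : ℝ}

/-- The weights `p c ^ r` of the transitions. -/
noncomputable def transWeight (P c : Matrix (Fin N) (Fin N) ℝ) (r : ℝ) :
    Matrix (Fin N) (Fin N) ℝ :=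
  Matrix.of fun i j => P i j * c i j ^ r

theorem wordWeight_transWeight (hc0 : ∀ i j, 0 ≤ c i j) (r : ℝ) :
    ∀ σ : List (Fin N), wordWeight (transWeight P c r) σ = wordWeight P σ * wordWeight c σ ^ r
  | [] => by simp [wordWeight]
  | [_] => by simp [wordWeight]
  | i :: j :: l => by
    have hnn : ∀ σ : List (Fin N), 0 ≤ wordWeight c σ := by
      intro σ
      rcases eq_or_ne σ [] with rfl | hσ
      · exact zero_le_one
      · obtain ⟨x, k, rfl⟩ := exists_eq_initWord hσ
        rw [wordWeight_initWord]
        exact Finset.prod_nonneg fun _ _ => hc0 _ _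
    rw [wordWeight, wordWeight, wordWeight, wordWeight_transWeight hc0 r (j :: l),
      Real.mul_rpow (hc0 i j) (hnn _)]
    simp only [transWeight, Matrix.of_apply]
    ring

theorem quantError_rpow_le_lintegral (nrm : Seminorm ℝ E) (μ : Measure E) (hr : 0 < r) {k : ℕ}
    {α : Finset E} (h1 : 1 ≤ α.card) (hk : α.card ≤ k) :
    quantError nrm μ r k ^ r ≤ ∫⁻ x, distTo nrm x α ^ r ∂μ := by
  have h2 : quantError nrm μ r k ≤ (∫⁻ x, distTo nrm x α ^ r ∂μ) ^ (1 / r) :=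
    iInf₂_le α ⟨h1, hk⟩
  calc _ ≤ ((∫⁻ x, distTo nrm x α ^ r ∂μ) ^ (1 / r)) ^ r := ENNReal.rpow_le_rpow h2 hr.le
    _ = _ := by rw [← ENNReal.rpow_mul, one_div_mul_cancel hr.ne', ENNReal.rpow_one]

theorem le_quantError_rpow (nrm : Seminorm ℝ E) (μ : Measure E) (hr : 0 < r) {k : ℕ} {X : ℝ≥0∞}
    (h : ∀ α : Finset E, α.card ≤ k → X ≤ ∫⁻ x, distTo nrm x α ^ r ∂μ) :
    X ≤ quantError nrm μ r k ^ r := by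
  have h2 : X ^ (1 / r) ≤ quantError nrm μ r k :=
    le_iInf₂ fun α hα => ENNReal.rpow_le_rpow (h α hα.2) (by positivity)
  calc X = (X ^ (1 / r)) ^ r := by
        rw [← ENNReal.rpow_mul, one_div_mul_cancel hr.ne', ENNReal.rpow_one]
    _ ≤ _ := ENNReal.rpow_le_rpow h2 hr.le

variable [BorelSpace E]

theorem measurable_distTo {nrm : Seminorm ℝ E} (hnrm : Continuous nrm) (α : Finset E) :
    Measurable fun x => distTo nrm x α := by
  unfold distTo
  refine Measurable.biInf (α : Set E) α.countable_toSet fun a _ => ?_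
  exact ENNReal.measurable_ofReal.comp
    ((hnrm.comp (continuous_id.sub continuous_const)).measurable)

theorem lintegral_markovTypeMeasure (hJ : IsCylinderSystem P c J) (hc0 : ∀ i j, 0 ≤ c i j)
    (hc1 : ∀ i j, c i j < 1) (hP : ∀ i, P i ∈ stdSimplex ℝ (Fin N))
    (hχ : χ ∈ stdSimplex ℝ (Fin N)) {nrm : Seminorm ℝ E} (hnrm : Continuous nrm) (α : Finset E) :
    ∫⁻ x, distTo nrm x α ^ r ∂markovTypeMeasure P χ hP hχ J =
      ∫⁻ ω, distTo nrm (proj P J ω) α ^ r ∂markovMeasure P χ hP hχ := by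
  rw [markovTypeMeasure, lintegral_map ((measurable_distTo hnrm α).pow_const r)
    (hJ.measurable_proj hc0 hc1)]

variable [FiniteDimensional ℝ E]

/-- Put one point in each cut cylinder set: each costs at most K₂^r ε, because μ̃[σ] (diam J_σ)^r ≤
wordWeight < ε. -/
theorem quantError_rpow_le (hJ : IsCylinderSystem P c J) (hr : 0 < r) (hc0 : ∀ i j, 0 ≤ c i j)
    (hc1 : ∀ i j, c i j < 1) (hcP : ∀ i j, 0 < c i j ↔ 0 < P i j)
    (hP : ∀ i, P i ∈ stdSimplex ℝ (Fin N)) (hχ : χ ∈ stdSimplex ℝ (Fin N))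
    (nrm : Seminorm ℝ E) (hnrm : ∀ x, nrm x = 0 → x = 0)
    (hb : HasBounds (transWeight P c r) η ρ)
    (hPh : ∀ i j, 0 < P i j ↔ 0 < transWeight P c r i j) :
    ∃ C > 0, ∀ n ε k, ρ ^ n < ε → ∑ i, (cutWords (transWeight P c r) n i ε).card ≤ k →
      quantError nrm (markovTypeMeasure P χ hP hχ J) r k ^ r ≤ ENNReal.ofReal (C * (ε * k)) := by
  classical
  obtain ⟨hcont, K₁, hK₁, K₂, hK₂, hK⟩ := nrm.exists_equiv_norm hnrm
  refine ⟨K₂ ^ r, by positivity, fun n ε k hε hk => ?_⟩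
  have hε0 : 0 < ε := (pow_pos hb.rho_pos _).trans hε
  rw [← card_allCutWords] at hk
  set Λ := allCutWords (transWeight P c r) n ε with hΛ
  have hcons : ∀ σ ∈ Λ, ∃ i τ, σ = i :: τ ∧ IsWord P σ ∧ wordWeight (transWeight P c r) σ < ε := by
    intro σ hσ
    obtain ⟨i, hi⟩ := mem_allCutWords.1 hσ
    obtain ⟨τ, rfl⟩ := exists_eq_cons_of_mem_cutWords hi
    exact ⟨i, τ, rfl, isWord_of_mem_cutWords hPh hi, wordWeight_lt_of_mem_cutWords hb hε hi⟩
  set pick : List (Fin N) → E := fun σ => if h : (J σ).Nonempty then h.some else 0 with hpick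
  have hpickJ : ∀ σ ∈ Λ, pick σ ∈ J σ := by
    intro σ hσ
    obtain ⟨i, τ, rfl, hw, -⟩ := hcons σ hσ
    have hne := hJ.nonempty_word hw (List.cons_ne_nil i τ)
    simp only [hpick, dif_pos hne]
    exact hne.some_mem
  have hΛne : Λ.Nonempty := by
    have := isProbabilityMeasure_markovMeasure hP hχ
    obtain ⟨ω, hω⟩ := (ae_mem_infWords hP hχ).exists
    obtain ⟨σ, hσ, -⟩ := exists_mem_cutWords_of_mem_infWords hPh n ε hω
    exact ⟨σ, mem_allCutWords.2 ⟨_, hσ⟩⟩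
  refine (quantError_rpow_le_lintegral nrm _ hr (α := Λ.image pick)
    (Finset.card_pos.2 (hΛne.image _)) (Finset.card_image_le.trans hk)).trans ?_
  rw [lintegral_markovTypeMeasure hJ hc0 hc1 hP hχ hcont]
  have hpt : ∀ᵐ ω ∂markovMeasure P χ hP hχ, distTo nrm (proj P J ω) (Λ.image pick) ^ r ≤
      ∑ σ ∈ Λ, (wordCylinder σ).indicator
        (fun _ => ENNReal.ofReal ((K₂ * wordWeight c σ) ^ r)) ω := by
    filter_upwards [ae_mem_infWords hP hχ] with ω hω
    obtain ⟨σ, hσ, hωσ⟩ := exists_mem_cutWords_of_mem_infWords hPh n ε hω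
    have hσΛ : σ ∈ Λ := mem_allCutWords.2 ⟨_, hσ⟩
    obtain ⟨i, τ, rfl, hw, -⟩ := hcons σ hσΛ
    refine le_trans ?_ (Finset.single_le_sum (fun _ _ => zero_le) hσΛ)
    rw [Set.indicator_of_mem hωσ]
    have hcw : 0 < wordWeight c (i :: τ) := wordWeight_pos (fun i j => (hcP i j).2) hw
    rw [← ENNReal.ofReal_rpow_of_nonneg (by positivity) hr.le]
    refine ENNReal.rpow_le_rpow ?_ hr.le
    refine (iInf₂_le (pick (i :: τ)) (Finset.mem_image_of_mem _ hσΛ)).trans ?_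
    refine ENNReal.ofReal_le_ofReal ((hK _).2.trans ?_)
    refine mul_le_mul_of_nonneg_left ?_ hK₂.le
    rw [← hJ.diam_word hw (List.cons_ne_nil i τ), ← dist_eq_norm]
    exact Metric.dist_le_diam_of_mem (hJ.isCompact_word hw (List.cons_ne_nil i τ)).isBounded
      (hJ.proj_mem_of_mem_wordCylinder hω (List.cons_ne_nil i τ) hωσ) (hpickJ _ hσΛ)
  refine (lintegral_mono_ae hpt).trans ?_
  have hne : ∀ σ ∈ Λ, σ ≠ [] := by
    intro σ hσ
    obtain ⟨i, τ, rfl, -⟩ := hcons σ hσ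
    simp
  rw [lintegral_finsetSum _ fun σ hσ =>
    measurable_const.indicator (measurableSet_wordCylinder (hne σ hσ))]
  calc ∑ σ ∈ Λ, ∫⁻ ω, (wordCylinder σ).indicator
        (fun _ => ENNReal.ofReal ((K₂ * wordWeight c σ) ^ r)) ω ∂markovMeasure P χ hP hχ
      ≤ ∑ σ ∈ Λ, ENNReal.ofReal (K₂ ^ r * ε) := by
        refine Finset.sum_le_sum fun σ hσ => ?_
        rw [lintegral_indicator_const (measurableSet_wordCylinder (hne σ hσ))]
        obtain ⟨i, τ, rfl, hw, hlt⟩ := hcons σ hσ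
        have hcw : 0 < wordWeight c (i :: τ) := wordWeight_pos (fun i j => (hcP i j).2) hw
        have hPw : 0 < wordWeight P (i :: τ) := wordWeight_pos (fun i j => id) hw
        rw [markovMeasure_wordCylinder, ← ENNReal.ofReal_mul (by positivity)]
        refine ENNReal.ofReal_le_ofReal ?_
        rw [wordWeight_transWeight hc0] at hlt
        have hχ1 : χ i ≤ 1 := by
          rw [← hχ.2]
          exact Finset.single_le_sum (fun j _ => hχ.1 j) (Finset.mem_univ i)
        calc (K₂ * wordWeight c (i :: τ)) ^ r * (χ i * wordWeight P (i :: τ))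
            = K₂ ^ r * (χ i * (wordWeight P (i :: τ) * wordWeight c (i :: τ) ^ r)) := by
              rw [Real.mul_rpow hK₂.le hcw.le]; ring
          _ ≤ K₂ ^ r * (1 * ε) := by
              gcongr
          _ = _ := by ring
    _ = ENNReal.ofReal (Λ.card * (K₂ ^ r * ε)) := by
        rw [Finset.sum_const, nsmul_eq_mul, ENNReal.ofReal_mul (p := (Λ.card : ℝ)) (by positivity),
          ENNReal.ofReal_natCast]
    _ ≤ _ := by
        refine ENNReal.ofReal_le_ofReal ?_
        have : (Λ.card : ℝ) ≤ k := by exact_mod_cast hk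
        calc (Λ.card : ℝ) * (K₂ ^ r * ε) ≤ k * (K₂ ^ r * ε) := by gcongr
          _ = _ := by ring

/-- A point lies within t/3 of the diameter of at most one cut cylinder set, so k points leave at
least k of the 2k cylinders unserved, each costing at least a constant times ε. -/
theorem le_quantError_rpow_of_isSeparated (hJ : IsCylinderSystem P c J) (hsep : IsSeparated P J)
    (hr : 0 < r) (hc0 : ∀ i j, 0 ≤ c i j)
    (hc1 : ∀ i j, c i j < 1) (hcP : ∀ i j, 0 < c i j ↔ 0 < P i j)
    (hP : ∀ i, P i ∈ stdSimplex ℝ (Fin N)) (hχ : χ ∈ stdSimplex ℝ (Fin N)) (hχ0 : ∀ i, 0 < χ i)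
    (nrm : Seminorm ℝ E) (hnrm : ∀ x, nrm x = 0 → x = 0)
    (hb : HasBounds (transWeight P c r) η ρ)
    (hPh : ∀ i j, 0 < P i j ↔ 0 < transWeight P c r i j) :
    ∃ C > 0, ∀ n ε k, ρ ^ n < ε → ε ≤ η⁻¹ →
      2 * k ≤ ∑ i, (cutWords (transWeight P c r) n i ε).card →
      ENNReal.ofReal (C * (ε * k)) ≤ quantError nrm (markovTypeMeasure P χ hP hχ J) r k ^ r := by
  classical
  obtain ⟨hcont, K₁, hK₁, K₂, hK₂, hK⟩ := nrm.exists_equiv_norm hnrm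
  obtain ⟨t, ht0, ht1, hsep⟩ := hsep
  obtain ⟨m, hm1, hm⟩ := exists_forall_le_mul (fun _ => (1 : ℝ)) hχ0 1
  have hm0 : 0 < m := by linarith
  have hχm : ∀ i, m⁻¹ ≤ χ i := fun i => by
    rw [inv_le_iff_one_le_mul₀ hm0, mul_comm]
    exact hm i
  have hη := hb.pos
  -- The factors come from the distance bound, from χ ≥ m⁻¹, and from the weight of a cut word being
  -- at least ηε.
  refine ⟨(K₁ * (t / 3)) ^ r * (m⁻¹ * η), by positivity, fun n ε k hε hεη hk => ?_⟩
  have hε0 : 0 < ε := (pow_pos hb.rho_pos _).trans hε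
  rw [← card_allCutWords] at hk
  set Λ := allCutWords (transWeight P c r) n ε with hΛ
  have hcons : ∀ σ ∈ Λ, ∃ i τ, σ = i :: τ ∧ IsWord P σ ∧
      η * ε ≤ wordWeight (transWeight P c r) σ := by
    intro σ hσ
    obtain ⟨i, hi⟩ := mem_allCutWords.1 hσ
    obtain ⟨τ, rfl⟩ := exists_eq_cons_of_mem_cutWords hi
    exact ⟨i, τ, rfl, isWord_of_mem_cutWords hPh hi,
      le_wordWeight_of_mem_cutWords hb hε0 hεη hi⟩
  have hne : ∀ σ ∈ Λ, σ ≠ [] := by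
    intro σ hσ
    obtain ⟨i, τ, rfl, -⟩ := hcons σ hσ
    simp
  have hdist : ∀ σ ∈ Λ, ∀ τ ∈ Λ, σ ≠ τ → ∀ x ∈ J σ, ∀ y ∈ J τ,
      t * max (Metric.diam (J σ)) (Metric.diam (J τ)) ≤ dist x y := by
    intro σ hσ τ hτ hne' x hx y hy
    obtain ⟨-, -, -, hwσ, -⟩ := hcons σ hσ
    obtain ⟨-, -, -, hwτ, -⟩ := hcons τ hτ
    obtain ⟨κ, a, b, hab, ha, hb⟩ := exists_branch_of_mem_allCutWords hσ hτ hne'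
    have hwa : IsWord P (κ ++ [a]) := List.IsChain.prefix hwσ ha
    have hwb : IsWord P (κ ++ [b]) := List.IsChain.prefix hwτ hb
    have hsa := hJ.subset_of_prefix hwσ (by simp) ha
    have hsb := hJ.subset_of_prefix hwτ (by simp) hb
    refine le_trans ?_ (hsep κ a b hab hwa hwb x (hsa hx) y (hsb hy))
    refine mul_le_mul_of_nonneg_left (max_le_max ?_ ?_) ht0.le
    · exact Metric.diam_mono hsa (hJ.isCompact_word hwa (by simp)).isBounded
    · exact Metric.diam_mono hsb (hJ.isCompact_word hwb (by simp)).isBounded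
  refine le_quantError_rpow nrm _ hr fun α hα => ?_
  rw [lintegral_markovTypeMeasure hJ hc0 hc1 hP hχ hcont]
  set bad : Finset (List (Fin N)) := Λ.filter fun σ =>
    ∃ a ∈ α, ∃ x ∈ J σ, dist x a < t / 3 * Metric.diam (J σ) with hbad
  have hbadcard : bad.card ≤ k := by
    refine le_trans ?_ hα
    have hex : ∀ σ ∈ bad, ∃ a ∈ α, ∃ x ∈ J σ, dist x a < t / 3 * Metric.diam (J σ) :=
      fun σ hσ => (Finset.mem_filter.1 hσ).2
    choose! f hf hfx using hex
    -- A shared centre would put two cylinder sets at distance below 2t/3, instead of t, times the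
    -- larger diameter.
    refine Finset.card_le_card_of_injOn f hf fun σ hσ τ hτ hστ => ?_
    by_contra hne'
    obtain ⟨x, hx, hxa⟩ := hfx σ hσ
    obtain ⟨y, hy, hya⟩ := hfx τ hτ
    rw [← hστ] at hya
    have h1 := hdist σ (Finset.mem_filter.1 hσ).1 τ (Finset.mem_filter.1 hτ).1 hne' x hx y hy
    have h2 := dist_triangle_right x y (f σ)
    have h3 := le_max_left (Metric.diam (J σ)) (Metric.diam (J τ))
    have h4 := le_max_right (Metric.diam (J σ)) (Metric.diam (J τ))
    have h5 : 0 ≤ max (Metric.diam (J σ)) (Metric.diam (J τ)) := le_max_of_le_left Metric.diam_nonneg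
    nlinarith
  set good := Λ \ bad with hgood
  have hgoodcard : k ≤ good.card := by
    have := Finset.card_sdiff_add_card_eq_card (Finset.filter_subset (fun σ =>
      ∃ a ∈ α, ∃ x ∈ J σ, dist x a < t / 3 * Metric.diam (J σ)) Λ)
    rw [← hbad, ← hgood] at this
    omega
  have hgoodΛ : ∀ σ ∈ good, σ ∈ Λ := fun σ hσ => (Finset.mem_sdiff.1 hσ).1
  have hcyl : ∀ σ ∈ good, ENNReal.ofReal ((K₁ * (t / 3)) ^ r * (m⁻¹ * η) * ε) ≤
      ∫⁻ ω in wordCylinder σ, distTo nrm (proj P J ω) α ^ r ∂markovMeasure P χ hP hχ := by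
    intro σ hσ
    have hσΛ := hgoodΛ σ hσ
    have hmeas := measurableSet_wordCylinder (hne σ hσΛ)
    obtain ⟨i, τ, rfl, hw, hle⟩ := hcons σ hσΛ
    have hcw : 0 < wordWeight c (i :: τ) := wordWeight_pos (fun i j => (hcP i j).2) hw
    have hPw : 0 < wordWeight P (i :: τ) := wordWeight_pos (fun i j => id) hw
    calc ENNReal.ofReal ((K₁ * (t / 3)) ^ r * (m⁻¹ * η) * ε)
        ≤ ENNReal.ofReal ((K₁ * (t / 3 * wordWeight c (i :: τ))) ^ r *
            (χ i * wordWeight P (i :: τ))) := by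
          refine ENNReal.ofReal_le_ofReal ?_
          rw [wordWeight_transWeight hc0] at hle
          calc (K₁ * (t / 3)) ^ r * (m⁻¹ * η) * ε = (K₁ * (t / 3)) ^ r * (m⁻¹ * (η * ε)) := by ring
            _ ≤ (K₁ * (t / 3)) ^ r *
                (χ i * (wordWeight P (i :: τ) * wordWeight c (i :: τ) ^ r)) := by
              have := hχm i
              gcongr
              exact (hχ0 i).le
            _ = _ := by
              rw [← mul_assoc K₁, Real.mul_rpow (x := K₁ * (t / 3)) (by positivity) hcw.le]; ring
      _ = ∫⁻ _ in wordCylinder (i :: τ),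
            ENNReal.ofReal ((K₁ * (t / 3 * wordWeight c (i :: τ))) ^ r)
              ∂markovMeasure P χ hP hχ := by
          rw [setLIntegral_const, markovMeasure_wordCylinder, ENNReal.ofReal_mul (by positivity)]
      _ ≤ _ := by
          refine setLIntegral_mono_ae' hmeas ?_
          filter_upwards [ae_mem_infWords hP hχ] with ω hω hωσ
          rw [← ENNReal.ofReal_rpow_of_nonneg (by positivity) hr.le]
          refine ENNReal.rpow_le_rpow (le_iInf₂ fun a ha => ?_) hr.le
          refine ENNReal.ofReal_le_ofReal (le_trans ?_ (hK _).1)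
          refine mul_le_mul_of_nonneg_left ?_ hK₁.le
          rw [← dist_eq_norm, ← hJ.diam_word hw (List.cons_ne_nil i τ)]
          by_contra! hcon
          exact (Finset.mem_sdiff.1 hσ).2 (Finset.mem_filter.2 ⟨hσΛ, a, ha, _,
            hJ.proj_mem_of_mem_wordCylinder hω (List.cons_ne_nil i τ) hωσ, hcon⟩)
  calc ENNReal.ofReal ((K₁ * (t / 3)) ^ r * (m⁻¹ * η) * (ε * k))
      = k * ENNReal.ofReal ((K₁ * (t / 3)) ^ r * (m⁻¹ * η) * ε) := by
        rw [← ENNReal.ofReal_natCast, ← ENNReal.ofReal_mul (by positivity)]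
        congr 1
        ring
    _ ≤ good.card * ENNReal.ofReal ((K₁ * (t / 3)) ^ r * (m⁻¹ * η) * ε) := by
        gcongr
    _ ≤ ∑ σ ∈ good, ∫⁻ ω in wordCylinder σ, distTo nrm (proj P J ω) α ^ r
          ∂markovMeasure P χ hP hχ := by
        rw [← nsmul_eq_mul, ← Finset.sum_const]
        exact Finset.sum_le_sum hcyl
    _ = ∫⁻ ω in ⋃ σ ∈ good, wordCylinder σ, distTo nrm (proj P J ω) α ^ r
          ∂markovMeasure P χ hP hχ := by
        rw [lintegral_biUnion_finset]
        · exact (pairwiseDisjoint_wordCylinder n ε).subset fun σ hσ => hgoodΛ σ hσ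
        · exact fun σ hσ => measurableSet_wordCylinder (hne σ (hgoodΛ σ hσ))
    _ ≤ _ := setLIntegral_le_lintegral _ _

end QuantizationError

end MarkovQuantization

namespace MarkovQuantization

/-! ### From power bounds on the error to the dimension. -/

section Dimension

theorem tendsto_log_div_neg_log {e : ℕ → ℝ} {r s : ℝ} (hr : 0 < r) (hs : 0 < s)
    (hpos : ∀ᶠ n in atTop, 0 < e n)
    (hlow : ∃ C > 0, ∀ᶠ n : ℕ in atTop, C * (n : ℝ) ^ (-(r / s)) ≤ e n ^ r)
    (hup : ∀ s', s < s' → ∃ C > 0, ∀ᶠ n : ℕ in atTop, e n ^ r ≤ C * (n : ℝ) ^ (-(r / s'))) :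
    Tendsto (fun n : ℕ => Real.log n / (-Real.log (e n))) atTop (𝓝 s) := by
  have hlog : Tendsto (fun n : ℕ => Real.log n) atTop atTop :=
    Real.tendsto_log_atTop.comp tendsto_natCast_atTop_atTop
  have hconst : ∀ D : ℝ, Tendsto (fun n : ℕ => D / Real.log n) atTop (𝓝 0) := fun D =>
    hlog.const_div_atTop D
  -- The reciprocal is easier: its denominator log n has known sign and growth.
  suffices h : Tendsto (fun n : ℕ => -Real.log (e n) / Real.log n) atTop (𝓝 s⁻¹) by
    have := h.inv₀ (inv_ne_zero hs.ne')
    simpa [inv_div] using this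
  refine tendsto_order.2 ⟨fun a ha => ?_, fun a ha => ?_⟩
  · obtain ⟨w, hw, hws⟩ := exists_between (max_lt ha (inv_pos.2 hs))
    have hw0 : 0 < w := (le_max_right _ _).trans_lt hw
    have haw : a < w := (le_max_left _ _).trans_lt hw
    obtain ⟨C, hC, hle⟩ := hup w⁻¹ ((lt_inv_comm₀ hs hw0).2 hws)
    filter_upwards [hle, hpos, (hconst (Real.log C / r)).eventually_lt_const (sub_pos.2 haw),
      hlog.eventually_gt_atTop 0, eventually_gt_atTop 0] with n hn he hD hl hn0
    have hn0' : (0 : ℝ) < n := by exact_mod_cast hn0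
    have h1 := Real.log_le_log (Real.rpow_pos_of_pos he _) hn
    rw [Real.log_rpow he, Real.log_mul hC.ne' (Real.rpow_pos_of_pos hn0' _).ne',
      Real.log_rpow hn0'] at h1
    rw [lt_div_iff₀ hl]
    rw [div_lt_iff₀ hl, div_lt_iff₀ hr] at hD
    rw [div_inv_eq_mul] at h1
    have h2 : r * (a * Real.log n) < r * (-Real.log (e n)) := by linarith
    exact lt_of_mul_lt_mul_left h2 hr.le
  · obtain ⟨C, hC, hle⟩ := hlow
    filter_upwards [hle, hpos, (hconst (-Real.log C / r)).eventually_lt_const (sub_pos.2 ha),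
      hlog.eventually_gt_atTop 0, eventually_gt_atTop 0] with n hn he hD hl hn0
    have hn0' : (0 : ℝ) < n := by exact_mod_cast hn0
    have h1 := Real.log_le_log (mul_pos hC (Real.rpow_pos_of_pos hn0' _)) hn
    rw [Real.log_rpow he, Real.log_mul hC.ne' (Real.rpow_pos_of_pos hn0' _).ne',
      Real.log_rpow hn0'] at h1
    rw [div_lt_iff₀ hl]
    rw [div_lt_iff₀ hl, div_lt_iff₀ hr] at hD
    rw [div_eq_mul_inv r s] at h1
    have h2 : r * (-Real.log (e n)) < r * (a * Real.log n) := by linarith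
    exact lt_of_mul_lt_mul_left h2 hr.le

end Dimension

/-! ### From counts at level ε to errors with k points. -/

section ErrorAsymptotics

variable {N : ℕ} {h : Matrix (Fin N) (Fin N) ℝ} {η ρ θ r : ℝ} {e : ℕ → ℝ≥0∞}

theorem sum_normCount (n : ℕ) (ε : ℝ) :
    ∑ i, normCount h θ n i ε = ε ^ θ * ((∑ i, (cutWords h n i ε).card : ℕ) : ℝ) := by
  simp only [normCount, Nat.cast_sum, Finset.mul_sum]

theorem eventually_rpow_le (hb : HasBounds h η ρ) (hθ : 0 < θ)
    (hU : ∃ C > 0, ∀ n ε k, ρ ^ n < ε → ∑ i, (cutWords h n i ε).card ≤ k →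
      e k ^ r ≤ ENNReal.ofReal (C * (ε * k)))
    (hB : ∃ B, ∀ n i ε, ρ ^ n < ε → ε ≤ η⁻¹ → normCount h θ n i ε ≤ B) :
    ∃ C > 0, ∀ᶠ k : ℕ in atTop, e k ^ r ≤ ENNReal.ofReal (C * (k : ℝ) ^ (1 - θ⁻¹)) := by
  obtain ⟨C, hC, hU⟩ := hU
  obtain ⟨B, hB⟩ := hB
  set B' := max (N * B) 1 with hB'
  have hB'0 : 0 < B' := lt_max_of_lt_right one_pos
  refine ⟨C * B' ^ θ⁻¹, by positivity, ?_⟩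
  filter_upwards [eventually_ge_atTop ⌈B'⌉₊] with k hk
  have hkB : B' ≤ k := (Nat.le_ceil _).trans (by exact_mod_cast hk)
  have hk0 : (0 : ℝ) < k := hB'0.trans_le hkB
  -- This level makes the count bound B' ε^(-θ) equal to k.
  set ε := (B' / k) ^ θ⁻¹ with hε
  have hε0 : 0 < ε := by positivity
  have hεθ : ε ^ θ = B' / k := by rw [hε, Real.rpow_inv_rpow (by positivity) hθ.ne']
  have hε1 : ε ≤ 1 := Real.rpow_le_one (by positivity) ((div_le_one hk0).2 hkB) (by positivity)
  obtain ⟨n, hn⟩ := exists_pow_lt_of_lt_one hε0 hb.rho_lt_one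
  refine (hU n ε k hn ?_).trans (ENNReal.ofReal_le_ofReal (le_of_eq ?_))
  · have h1 : ∑ i, normCount h θ n i ε ≤ B' := by
      refine (Finset.sum_le_sum fun i _ =>
        hB n i ε hn (hε1.trans ((one_le_inv₀ hb.pos).2 hb.le_one))).trans ?_
      simp [hB']
    rw [sum_normCount, hεθ, div_mul_eq_mul_div, div_le_iff₀ hk0] at h1
    exact_mod_cast le_of_mul_le_mul_left h1 hB'0
  · rw [hε, Real.div_rpow hB'0.le hk0.le, sub_eq_add_neg, Real.rpow_add hk0, Real.rpow_one,
      Real.rpow_neg hk0.le]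
    ring

/-- The constant C is chosen before b, so arbitrarily large b force the coefficient to be infinite.
-/
theorem exists_forall_eventually_le_rpow (hb : HasBounds h η ρ) (hθ : 0 < θ)
    (hL : ∃ C > 0, ∀ n ε k, ρ ^ n < ε → ε ≤ η⁻¹ → 2 * k ≤ ∑ i, (cutWords h n i ε).card →
      ENNReal.ofReal (C * (ε * k)) ≤ e k ^ r) :
    ∃ C > 0, ∀ b > 0, (∃ ε₀ > 0, ∀ n ε, ρ ^ n < ε → ε ≤ ε₀ → b ≤ ∑ i, normCount h θ n i ε) →
      ∀ᶠ k : ℕ in atTop,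
        ENNReal.ofReal (C * (b / 2) ^ θ⁻¹ * (k : ℝ) ^ (1 - θ⁻¹)) ≤ e k ^ r := by
  obtain ⟨C, hC, hL⟩ := hL
  refine ⟨C, hC, fun b hb0 ⟨ε₀, hε₀, hcount⟩ => ?_⟩
  have hη := hb.pos
  have hlim : Tendsto (fun k : ℕ => (b / 2 / (k : ℝ)) ^ θ⁻¹) atTop (𝓝 0) := by
    have h1 : Tendsto (fun k : ℕ => b / 2 / (k : ℝ)) atTop (𝓝 0) :=
      tendsto_natCast_atTop_atTop.const_div_atTop _
    have h2 := h1.rpow_const (p := θ⁻¹) (.inr (by positivity))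
    rwa [Real.zero_rpow (by positivity)] at h2
  filter_upwards [hlim.eventually_lt_const (lt_min hε₀ (inv_pos.2 hη)), eventually_gt_atTop 0]
    with k hk hk0
  have hk0' : (0 : ℝ) < k := by exact_mod_cast hk0
  -- This level makes the count bound b ε^(-θ) equal to 2k.
  set ε := (b / 2 / (k : ℝ)) ^ θ⁻¹ with hε
  have hε0 : 0 < ε := by positivity
  have hεθ : ε ^ θ = b / 2 / k := by rw [hε, Real.rpow_inv_rpow (by positivity) hθ.ne']
  obtain ⟨n, hn⟩ := exists_pow_lt_of_lt_one hε0 hb.rho_lt_one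
  refine le_trans (ENNReal.ofReal_le_ofReal (le_of_eq ?_))
    (hL n ε k hn (hk.le.trans (min_le_right _ _)) ?_)
  · rw [hε, Real.div_rpow (by positivity) hk0'.le, sub_eq_add_neg, Real.rpow_add hk0',
      Real.rpow_one, Real.rpow_neg hk0'.le]
    ring
  · have h1 := hcount n ε hn (hk.le.trans (min_le_left _ _))
    rw [sum_normCount, hεθ, div_div, div_mul_eq_mul_div, le_div_iff₀ (by positivity)] at h1
    exact_mod_cast le_of_mul_le_mul_left h1 hb0

end ErrorAsymptotics

/-! ### The critical exponent s and its parameter θ = s / (s + r). -/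

section CriticalExponent

variable {N : ℕ} {P c : Matrix (Fin N) (Fin N) ℝ} {r : ℝ}

theorem specRad_eq_blockRadius (P c : Matrix (Fin N) (Fin N) ℝ) (r : ℝ) (H : Finset (Fin N))
    (s : ℝ) :
    specRad P c r H s = blockRadius (powMatrix (transWeight P c r) (s / (s + r))) H := rfl

theorem isCriticalExponent_of_specRad_eq_one {η ρ : ℝ}
    (hb : HasBounds (transWeight P c r) η ρ) (hr : 0 < r) {H : Finset (Fin N)} {s : ℝ} (hs : 0 < s)
    (h1 : specRad P c r H s = 1) : IsCriticalExponent P c r H s := by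
  have hlt : ∀ s s' : ℝ, 0 < s → s < s' → specRad P c r H s = 1 → specRad P c r H s' < 1 := by
    intro s s' hs hss' h1
    rw [specRad_eq_blockRadius] at h1 ⊢
    refine hb.blockRadius_lt_one (by positivity) ?_ h1.le
    rw [div_lt_div_iff₀ (by positivity) (by linarith)]
    nlinarith
  refine ⟨⟨hs, h1⟩, fun s' hs' h1' => ?_⟩
  rcases lt_trichotomy s' s with h | h | h
  · exact absurd h1 (hlt s' s hs' h h1').ne
  · exact h
  · exact absurd h1' (hlt s s' hs h h1).ne

theorem criticalComponents_eq_unitComponents {η ρ : ℝ}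
    (hb : HasBounds (transWeight P c r) η ρ) (hr : 0 < r) {s : ℝ} (hs : 0 < s) :
    criticalComponents P c r s = unitComponents P (transWeight P c r) (s / (s + r)) := by
  ext H
  exact ⟨fun h => ⟨h.1, h.2.1.2⟩,
    fun h => ⟨h.1, isCriticalExponent_of_specRad_eq_one hb hr hs h.2⟩⟩

theorem transWeight_pos_iff (hc0 : ∀ i j, 0 ≤ c i j) (hcP : ∀ i j, 0 < c i j ↔ 0 < P i j)
    (i j : Fin N) : 0 < P i j ↔ 0 < transWeight P c r i j := by
  refine ⟨fun h => mul_pos h (Real.rpow_pos_of_pos ((hcP i j).2 h) _), fun h => ?_⟩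
  exact pos_of_mul_pos_left h (Real.rpow_nonneg (hc0 i j) _)

theorem exists_critical_exponent [Nonempty (Fin N)] (hr : 0 < r)
    (hP : ∀ i, P i ∈ stdSimplex ℝ (Fin N))
    (hP2 : ∀ i, 2 ≤ (Finset.univ.filter fun j => 0 < P i j).card)
    (hc0 : ∀ i j, 0 ≤ c i j) (hc1 : ∀ i j, c i j < 1) (hcP : ∀ i j, 0 < c i j ↔ 0 < P i j)
    {η ρ : ℝ} (hb : HasBounds (transWeight P c r) η ρ) :
    ∃ s > 0, specRad P c r Finset.univ s = 1 := by
  obtain ⟨ηc, ρc, hbc⟩ := exists_hasBounds hc0 hc1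
  obtain ⟨θ, hθ0, hθ1, hθ⟩ := hb.exists_blockRadius_eq_one (q := ρc ^ r) (fun i => by
      refine (hP2 i).trans (le_of_eq ?_)
      congr 1
      exact Finset.filter_congr fun j _ => transWeight_pos_iff hc0 hcP i j)
    (Real.rpow_lt_one hbc.rho_pos.le hbc.rho_lt_one hr) (fun i => by
      calc ∑ j, transWeight P c r i j ≤ ∑ j, P i j * ρc ^ r :=
            Finset.sum_le_sum fun j _ => mul_le_mul_of_nonneg_left
              (Real.rpow_le_rpow (hc0 i j) (hbc.le_rho i j) hr.le) ((hP i).1 j)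
        _ = ρc ^ r := by rw [← Finset.sum_mul, (hP i).2, one_mul])
  have h1 : 0 < 1 - θ := by linarith
  -- This solves s / (s + r) = θ for s.
  refine ⟨r * θ / (1 - θ), by positivity, ?_⟩
  rw [specRad_eq_blockRadius]
  have h2 : r * θ / (1 - θ) / (r * θ / (1 - θ) + r) = θ := by
    field_simp
    ring
  rw [h2, hθ]

theorem exists_hasBounds_transWeight (hr : 0 < r) (hP : ∀ i, P i ∈ stdSimplex ℝ (Fin N))
    (hc0 : ∀ i j, 0 ≤ c i j) (hc1 : ∀ i j, c i j < 1) :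
    ∃ η ρ, HasBounds (transWeight P c r) η ρ := by
  refine exists_hasBounds (fun i j => mul_nonneg ((hP i).1 j) (Real.rpow_nonneg (hc0 i j) _))
    fun i j => ?_
  have h1 : P i j ≤ 1 := by
    rw [← (hP i).2]
    exact Finset.single_le_sum (fun k _ => (hP i).1 k) (Finset.mem_univ j)
  have h2 : c i j ^ r < 1 := Real.rpow_lt_one (hc0 i j) (hc1 i j) hr
  exact (mul_le_of_le_one_left (Real.rpow_nonneg (hc0 i j) _) h1).trans_lt h2

end CriticalExponent

/-! ### Quantization coefficients and dimensions from eventual bounds. -/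

section Coefficients

theorem natCast_rpow_mul_ofReal {k : ℕ} (hk : 0 < k) {D p : ℝ} :
    (k : ℝ≥0∞) ^ p * ENNReal.ofReal (D * (k : ℝ) ^ (-p)) = ENNReal.ofReal D := by
  have hk0 : (0 : ℝ) < k := by exact_mod_cast hk
  rw [← ENNReal.ofReal_natCast, ENNReal.ofReal_rpow_of_pos hk0,
    ← ENNReal.ofReal_mul (by positivity), mul_comm D, ← mul_assoc, ← Real.rpow_add hk0]
  simp

variable {E : Type*} [NormedAddCommGroup E] [NormedSpace ℝ E] [MeasurableSpace E]
  {nrm : Seminorm ℝ E} {μ : Measure E} {r s D : ℝ}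

theorem ofReal_le_lowerQuantCoeff
    (h : ∀ᶠ k : ℕ in atTop, ENNReal.ofReal (D * (k : ℝ) ^ (-(r / s))) ≤ quantError nrm μ r k ^ r) :
    ENNReal.ofReal D ≤ lowerQuantCoeff nrm μ r s := by
  refine le_liminf_of_le (h := ?_)
  filter_upwards [h, eventually_gt_atTop 0] with k hk hk0
  rw [← natCast_rpow_mul_ofReal hk0 (p := r / s)]
  gcongr

theorem upperQuantCoeff_le_ofReal
    (h : ∀ᶠ k : ℕ in atTop, quantError nrm μ r k ^ r ≤ ENNReal.ofReal (D * (k : ℝ) ^ (-(r / s)))) :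
    upperQuantCoeff nrm μ r s ≤ ENNReal.ofReal D := by
  refine limsup_le_of_le (h := ?_)
  filter_upwards [h, eventually_gt_atTop 0] with k hk hk0
  rw [← natCast_rpow_mul_ofReal hk0 (p := r / s)]
  gcongr

theorem lowerQuantCoeff_le_upperQuantCoeff :
    lowerQuantCoeff nrm μ r s ≤ upperQuantCoeff nrm μ r s :=
  liminf_le_limsup

theorem quantDim_eq (hr : 0 < r) (hs : 0 < s)
    (hlow : ∃ C > 0, ∀ᶠ k : ℕ in atTop,
      ENNReal.ofReal (C * (k : ℝ) ^ (-(r / s))) ≤ quantError nrm μ r k ^ r)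
    (hup : ∀ s', s < s' → ∃ C > 0, ∀ᶠ k : ℕ in atTop,
      quantError nrm μ r k ^ r ≤ ENNReal.ofReal (C * (k : ℝ) ^ (-(r / s')))) :
    lowerQuantDim nrm μ r = (s : EReal) ∧ upperQuantDim nrm μ r = (s : EReal) := by
  -- `toReal` sends ⊤ to 0, so finiteness must be known before passing to real numbers.
  have hfin : ∀ᶠ k : ℕ in atTop, quantError nrm μ r k ≠ ⊤ := by
    obtain ⟨C, -, hC⟩ := hup (s + 1) (by linarith)
    filter_upwards [hC] with k hk htop
    rw [htop, ENNReal.top_rpow_of_pos hr] at hk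
    exact absurd hk (by simp)
  have hreal : ∀ k, (quantError nrm μ r k).toReal ^ r = (quantError nrm μ r k ^ r).toReal :=
    fun k => ENNReal.toReal_rpow _ _
  have hlow' : ∃ C > 0, ∀ᶠ k : ℕ in atTop,
      C * (k : ℝ) ^ (-(r / s)) ≤ (quantError nrm μ r k).toReal ^ r := by
    obtain ⟨C, hC, hle⟩ := hlow
    refine ⟨C, hC, ?_⟩
    filter_upwards [hle, hfin] with k hk hk'
    rw [hreal]
    exact (ENNReal.ofReal_le_iff_le_toReal (ENNReal.rpow_ne_top_of_nonneg hr.le hk')).1 hk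
  have key : Tendsto (fun k : ℕ => Real.log k / (-Real.log (quantError nrm μ r k).toReal)) atTop
      (𝓝 s) := by
    refine tendsto_log_div_neg_log hr hs ?_ hlow' fun s' hs' => ?_
    · obtain ⟨C, hC, hle⟩ := hlow'
      filter_upwards [hle, eventually_gt_atTop 0] with k hk hk0
      have hk0' : (0 : ℝ) < k := by exact_mod_cast hk0
      refine ENNReal.toReal_nonneg.lt_of_ne' fun h0 => ?_
      rw [h0, Real.zero_rpow hr.ne'] at hk
      have : 0 < C * (k : ℝ) ^ (-(r / s)) := by positivity
      linarith
    · obtain ⟨C, hC, hle⟩ := hup s' hs'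
      refine ⟨C, hC, ?_⟩
      filter_upwards [hle] with k hk
      rw [hreal]
      exact ENNReal.toReal_le_of_le_ofReal (by positivity) hk
  have key' := (continuous_coe_real_ereal.tendsto s).comp key
  exact ⟨key'.liminf_eq, key'.limsup_eq⟩

end Coefficients

end MarkovQuantization

/-! ### The main theorem. -/

open MarkovQuantization in
theorem theorem1 {E : Type*} [NormedAddCommGroup E] [NormedSpace ℝ E] [FiniteDimensional ℝ E]
    [MeasurableSpace E] [BorelSpace E]
    (nrm : Seminorm ℝ E) (hnrm : ∀ x, nrm x = 0 → x = 0)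
    (N : ℕ) (P c : Matrix (Fin N) (Fin N) ℝ) (χ : Fin N → ℝ) (J : List (Fin N) → Set E)
    (r : ℝ) (hr : 0 < r)
    (hP : ∀ i, P i ∈ stdSimplex ℝ (Fin N))
    (hP2 : ∀ i, 2 ≤ (Finset.univ.filter fun j => 0 < P i j).card)
    (hc0 : ∀ i j, 0 ≤ c i j) (hc1 : ∀ i j, c i j < 1) (hcP : ∀ i j, 0 < c i j ↔ 0 < P i j)
    (hχ : χ ∈ stdSimplex ℝ (Fin N)) (hχ0 : ∀ i, 0 < χ i)
    (hJ : IsCylinderSystem P c J) (hsep : IsSeparated P J) :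
    ∃ s : ℝ, IsCriticalExponent P c r Finset.univ s ∧
      lowerQuantDim nrm (markovTypeMeasure P χ hP hχ J) r = (s : EReal) ∧
      upperQuantDim nrm (markovTypeMeasure P χ hP hχ J) r = (s : EReal) ∧
      0 < lowerQuantCoeff nrm (markovTypeMeasure P χ hP hχ J) r s ∧
      (upperQuantCoeff nrm (markovTypeMeasure P χ hP hχ J) r s < ⊤ ↔
        (criticalComponents P c r s).Pairwise (Incomparable P)) ∧
      (¬ (criticalComponents P c r s).Pairwise (Incomparable P) →
        lowerQuantCoeff nrm (markovTypeMeasure P χ hP hχ J) r s = ⊤) := by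
  have hne : Nonempty (Fin N) := by
    by_contra hempty
    rw [not_nonempty_iff] at hempty
    simpa using hχ.2
  obtain ⟨η, ρ, hb⟩ := exists_hasBounds_transWeight hr hP hc0 hc1
  have hPh := transWeight_pos_iff (r := r) hc0 hcP
  obtain ⟨s, hs, hs1⟩ := exists_critical_exponent hr hP hP2 hc0 hc1 hcP hb
  have hexp : ∀ s : ℝ, 0 < s → 1 - (s / (s + r))⁻¹ = -(r / s) := fun s hs => by
    field_simp
    ring
  have hθ : 0 < s / (s + r) := by positivity
  have hrad := specRad_eq_blockRadius P c r Finset.univ s ▸ hs1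
  have hU := quantError_rpow_le hJ hr hc0 hc1 hcP hP hχ nrm hnrm hb hPh
  obtain ⟨C, hC, hL⟩ := exists_forall_eventually_le_rpow hb hθ
    (le_quantError_rpow_of_isSeparated hJ hsep hr hc0 hc1 hcP hP hχ hχ0 nrm hnrm hb hPh)
  rw [hexp s hs] at hL
  obtain ⟨b, hb0, hcount⟩ := hb.exists_le_normCount hθ hrad.ge
  have hlow := hL b hb0 ⟨1, one_pos, fun n ε hε _ => hcount n ε hε⟩
  -- For s' > s the parameter θ' exceeds θ, so the matrix is subcritical and the counts are bounded.
  have hdim := quantDim_eq hr hs ⟨C * (b / 2) ^ (s / (s + r))⁻¹, by positivity, hlow⟩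
    fun s' hs' => by
      have hs'0 : 0 < s' := hs.trans hs'
      have hθ' : 0 < s' / (s' + r) := by positivity
      have h1 := eventually_rpow_le hb hθ' hU
        (hb.normCount_bounded_of_blockRadius_lt_one hθ' (hb.blockRadius_lt_one hθ (by
          rw [div_lt_div_iff₀ (by positivity) (by positivity)]
          nlinarith) hrad.le))
      rwa [hexp s' hs'0] at h1
  have htop : ¬ (criticalComponents P c r s).Pairwise (Incomparable P) →
      lowerQuantCoeff nrm (markovTypeMeasure P χ hP hχ J) r s = ⊤ := by
    intro hpw
    rw [criticalComponents_eq_unitComponents hb hr hs] at hpw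
    refine ENNReal.eq_top_of_forall_nnreal_le fun K => ?_
    have hK : (0 : ℝ) < K + 1 := by positivity
    -- This b turns the bound C (b / 2)^(1/θ) into K + 1.
    have h1 := ofReal_le_lowerQuantCoeff (hL (2 * ((K + 1) / C) ^ (s / (s + r))) (by positivity)
      (le_normCount_of_not_pairwise hb hθ hPh hpw _))
    refine le_trans ?_ h1
    rw [mul_div_cancel_left₀ _ two_ne_zero, Real.rpow_rpow_inv (by positivity) hθ.ne',
      mul_div_cancel₀ _ hC.ne', ← ENNReal.ofReal_coe_nnreal]
    exact ENNReal.ofReal_le_ofReal (by linarith)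
  refine ⟨s, isCriticalExponent_of_specRad_eq_one hb hr hs hs1, hdim.1, hdim.2, ?_,
    ⟨fun hfin => ?_, fun hpw => ?_⟩, htop⟩
  · refine lt_of_lt_of_le ?_ (ofReal_le_lowerQuantCoeff hlow)
    rw [ENNReal.ofReal_pos]
    positivity
  · by_contra hpw
    have h1 := htop hpw ▸ lowerQuantCoeff_le_upperQuantCoeff
      (nrm := nrm) (μ := markovTypeMeasure P χ hP hχ J) (r := r) (s := s)
    exact absurd (top_le_iff.1 h1) hfin.ne
  · rw [criticalComponents_eq_unitComponents hb hr hs] at hpw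
    obtain ⟨C', -, h1⟩ := eventually_rpow_le hb hθ hU
      (normCount_bounded_of_pairwise hb hθ hPh hrad hpw)
    rw [hexp s hs] at h1
    exact (upperQuantCoeff_le_ofReal h1).trans_lt ENNReal.ofReal_lt_top
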